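/- Let $N\ge 2$. Consider a quantum network with nodes Alice ($A$), a router ($C$) and $N-1$ parties $B_1,\dots,B_{N-1}$ (the Bobs), and directed channels $A\to C$ and $C\to B_i$ ($1\le i\le N-1$). In one network use every channel transmits at most one qubit. Initially every node holds only local qubits in the state $|0\rangle$. All nodes may perform arbitrary local quantum operations between transmissions; the statements below hold both without classical communication and with free classical communication between all nodes. For a pure state, $E_{A|B}$ denotes the entropy of entanglement, i.e. the von Neumann entropy in bits of the reduced state of one side of the cut $A|B$, where $B$ consists of the router and all Bobs. An $N$-party GHZ state is $(|0\rangle^{\otimes N}+|1\rangle^{\otimes N})/\sqrt2$, and "$N-1$ Bell pairs" means one Bell pair $(|00\rangle+|11\rangle)/\sqrt2$ shared by $A$ and $B_i$ for each $i$. 1. Moving one qubit of a pure state from one side of a cut to the other raises the entropy of entanglement by at most $1$. Moreover, a pure state that can be distributed by sending $k$ qubits from $A$ to $B$ (even if all of $B$ may act jointly) has $E_{A|B}\le k$; in particular $E_{A|B}\le 1$ if a single qubit is sent. 2. $N-1$ Bell pairs have $E_{A|B}=N-1$. 3. If $N\ge 3$, then $N-1$ Bell pairs cannot be distributed by a protocol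 in which at most one qubit is sent from Alice to the router, however often the channels $C\to B_i$ are used, and not even if the router and all Bobs act jointly as a single party. 4. The smallest number of network uses with which $N-1$ Bell pairs can be distributed (one round of the bipartite protocol, 2QKD) is exactly $N-1$. The smallest number of network uses with which the $N$-party GHZ state can be distributed (one round of the multipartite protocol, NQKD) is exactly $1$. 5. For $n\ge1$ Bobs sharing a state $\rho$ with Alice, let the asymptotic secret fraction be $$r_\infty=\sup_{U\leftarrow K}\ \inf_{\sigma\in\Gamma}\Bigl[S(U|E)-\max_{1\le i\le n}H(U|K_i)\Bigr].$$ Here $K$ and $K_i$ are the $Z$-measurement outcomes of Alice and of Bob $i$, $U\leftarrow K$ is a bit channel, $E$ purifies $\sigma$, and $\Gamma$ is the set of states with the same values as $\rho$ of three kinds of error rates: $Q_Z=\Pr[\exists i: K_i\ne K]$, $Q_{AB_i}=\Pr[K_i\neq K]$, and $Q_X=(1-\langle X^{\otimes (n+1)}\rangle_{\rm dep})/2$, where $\langle X^{\otimes(n+1)}\rangle_{\rm dep}$ is the average, over all choices of $X$ or $Y$ for each party with an even number $\kappa$ of $Y$'s, of $(-1)^{\kappa/2}$ times the expectation of the product of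 the outcomes. Let the key rate be $R=r_\infty/t_{\rm rep}$, where $t_{\rm rep}$ is the smallest number of network uses that distributes the resource state of one round (one network use per unit of time). For 2QKD, $r_\infty$ is the minimum over $i$ of the secret fractions of the two-party keys obtained from the Bell pairs. In the ideal case, i.e. if the GHZ state, respectively the $N-1$ Bell pairs, are shared perfectly, $r_\infty=1$ for both protocols, and $R^{\rm NQKD}=(N-1)\,R^{\rm 2QKD}$ with $R^{\rm 2QKD}>0$. -/

import Mathlib

open scoped Matrix

namespace ConferenceQKD

noncomputable section

open Classical

/-! ## Registers of qubits

A register of qubits labelled by a finite type `Q` has the computational basis `Q → Bool`.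
Vectors are functions `(Q → Bool) → ℂ`, operators and states are matrices over the basis. -/

/-- Operators on a register of qubits labelled by `Q`. -/
abbrev QOp (Q : Type) := Matrix (Q → Bool) (Q → Bool) ℂ

/-- The operator `|ψ⟩⟨ψ|`. -/
def pureState {ι : Type} (ψ : ι → ℂ) : Matrix ι ι ℂ :=
  Matrix.of fun x y => ψ x * star (ψ y)

/-- The vector `|0…0⟩`. -/
def zeroVec (Q : Type) : (Q → Bool) → ℂ :=
  fun x => if x = fun _ => false then 1 else 0

/-- The reduced operator of `ρ` on the qubits `τ t` (relabelled by `t : T`): the partial trace over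
all qubits outside the range of `τ`. -/
def reduce {Q T : Type} [Fintype Q] (τ : T ↪ Q) (ρ : QOp Q) : QOp T :=
  Matrix.of fun a a' => ∑ x : Q → Bool, ∑ x' : Q → Bool,
    if (∀ t, x (τ t) = a t) ∧ (∀ t, x' (τ t) = a' t) ∧ (∀ q, q ∉ Set.range τ → x q = x' q)
    then ρ x x' else 0

/-! ## Entropies, in bits -/

/-- Shannon entropy of a distribution on a finite set. -/
def shannonEntropy {ι : Type} [Fintype ι] (p : ι → ℝ) : ℝ :=
  (∑ i, Real.negMulLog (p i)) / Real.log 2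

/-- Von Neumann entropy `- tr (ρ log₂ ρ)` of a density operator, through its eigenvalues
(the value on a non-Hermitian matrix is irrelevant). -/
def vonNeumannEntropy {ι : Type} [Fintype ι] (ρ : Matrix ι ι ℂ) : ℝ :=
  if h : ρ.IsHermitian then shannonEntropy h.eigenvalues else 0

/-- Entropy of entanglement of the pure state `ψ` across the cut of the register into the qubits
in `A` and the qubits outside `A`. -/
def entanglementEntropy {Q : Type} [Fintype Q] (A : Finset Q) (ψ : (Q → Bool) → ℂ) : ℝ :=
  vonNeumannEntropy (reduce (Function.Embedding.subtype (fun q => q ∈ A)) (pureState ψ))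

/-! ## Protocols in a quantum network

A network has nodes `V` and directed channels `C`, with end points given by `src` and `tgt`.
Every qubit is held by a node; `o : Q → V` says by which. -/

/-- `K` acts on the qubits held by node `v` only (as the identity on all others). -/
def IsLocalAt {V Q : Type} (o : Q → V) (v : V) (K : QOp Q) : Prop :=
  ∃ K' : QOp {q : Q // o q = v}, ∀ x y : Q → Bool,
    K x y = if (∀ q, o q ≠ v → x q = y q) then K' (fun q => x q) (fun q => y q) else 0

/-- `Run src tgt cc cs o ρ o' σ`: there is a protocol that starts with the qubits located according
to `o` in the (possibly subnormalised) state `ρ`, ends with the qubits located according to `o'` in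
the state `σ`, and transmits qubits over the channels in the list `cs`, in this order, one qubit for
each entry. Between transmissions the nodes may perform arbitrary local quantum instruments. An
instrument has Kraus operators `K k l`, where the outcome `l` is discarded and the outcome `k` is
announced to all nodes, which may let their later operations depend on it. Nontrivial announcements
are permitted only if `cc = true` (free classical communication between all nodes). -/
inductive Run {V C Q : Type} [Fintype Q] (src tgt : C → V) (cc : Bool) :
    List C → (Q → V) → QOp Q → (Q → V) → QOp Q → Prop
  | done (o : Q → V) (ρ : QOp Q) : Run src tgt cc [] o ρ o ρ
  | localOp {cs : List C} {o o' : Q → V} {ρ : QOp Q} (v : V) (a b : ℕ)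
      (K : Fin a → Fin b → QOp Q) (hlocal : ∀ k l, IsLocalAt o v (K k l))
      (htrace : ∑ k, ∑ l, (K k l)ᴴ * K k l = 1) (hcc : cc = true ∨ a = 1)
      (σ : Fin a → QOp Q)
      (hrest : ∀ k, Run src tgt cc cs o (∑ l, K k l * ρ * (K k l)ᴴ) o' (σ k)) :
      Run src tgt cc cs o ρ o' (∑ k, σ k)
  | send {cs : List C} {o o' : Q → V} {ρ σ : QOp Q} (c : C) (q : Q) (hq : o q = src c)
      (hrest : Run src tgt cc cs (Function.update o q (tgt c)) ρ o' σ) :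
      Run src tgt cc (c :: cs) o ρ o' σ

/-- By transmitting qubits over the channels `cs` (one for each entry, in this order) one can
distribute the state `ρ` of qubits labelled by `T`, with qubit `t` ending at node `loc t`. Initially
there is no entanglement or correlation: every node holds any number of local qubits in `|0⟩`. -/
def Distributes {V C T : Type} (src tgt : C → V) (cc : Bool) (cs : List C)
    (loc : T → V) (ρ : QOp T) : Prop :=
  ∃ (n : ℕ) (o o' : Fin n → V) (σ : QOp (Fin n)) (τ : T ↪ Fin n),
    Run src tgt cc cs o (pureState (zeroVec (Fin n))) o' σ ∧
    (∀ t, o' (τ t) = loc t) ∧ reduce τ σ = ρ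

/-- The state can be distributed with `n` uses of the network. In a single use every channel
transmits at most one qubit (in any order, with local operations in between). -/
def DistributesInUses {V C T : Type} (src tgt : C → V) (cc : Bool) (n : ℕ)
    (loc : T → V) (ρ : QOp T) : Prop :=
  ∃ L : List (List C), L.length = n ∧ (∀ l ∈ L, l.Nodup) ∧
    Distributes src tgt cc L.flatten loc ρ

/-! ### The network with a central router -/

/-- Alice, the router and `m` Bobs. -/
inductive Node (m : ℕ) : Type
  | alice : Node m
  | router : Node m
  | bob (i : Fin m) : Node m

/-- Channels: `none` goes from Alice to the router, `some i` from the router to Bob `i`. -/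
abbrev Channel (m : ℕ) := Option (Fin m)

def chanSrc (m : ℕ) : Channel m → Node m
  | none => Node.alice
  | some _ => Node.router

def chanTgt (m : ℕ) : Channel m → Node m
  | none => Node.router
  | some i => Node.bob i

/-! ### The two-party network obtained by grouping the router and all Bobs into one party -/

inductive Side : Type
  | A : Side
  | B : Side

/-- The only channel of the grouped network goes from `A` to `B`. -/
def cutSrc : Unit → Side := fun _ => Side.A

def cutTgt : Unit → Side := fun _ => Side.B

/-- The side of the cut on which a node lies. -/
def side {m : ℕ} : Node m → Side
  | Node.alice => Side.A
  | Node.router => Side.B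
  | Node.bob _ => Side.B

/-! ### The resource states -/

/-- The `2m` qubits of `m` pairs: `(i, false)` is Alice's and `(i, true)` is Bob `i`'s. -/
abbrev PairQubit (m : ℕ) := Fin m × Bool

def pairLoc (m : ℕ) : PairQubit m → Node m
  | (_, false) => Node.alice
  | (i, true) => Node.bob i

/-- Alice's qubits in `m` pairs. -/
def alicePairQubits (m : ℕ) : Finset (PairQubit m) :=
  Finset.univ.filter fun t => t.2 = false

/-- `m` Bell pairs: the tensor product over `i` of `(|00⟩ + |11⟩)/√2` on Alice's `i`-th qubit and
Bob `i`'s qubit. -/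
def bellPairs (m : ℕ) : (PairQubit m → Bool) → ℂ :=
  fun x => ∏ i : Fin m, if x (i, false) = x (i, true) then (1 / (Real.sqrt 2 : ℂ)) else 0

/-- One qubit for Alice (`none`) and one for each of `m` Bobs (`some i`). -/
abbrev PartyQubit (m : ℕ) := Option (Fin m)

def partyLoc (m : ℕ) : PartyQubit m → Node m
  | none => Node.alice
  | some i => Node.bob i

/-- The state `(|0…0⟩ + |1…1⟩)/√2` of `m + 1` qubits. -/
def ghz (m : ℕ) : (PartyQubit m → Bool) → ℂ :=
  fun x => if (∀ t, x t = false) ∨ (∀ t, x t = true) then (1 / (Real.sqrt 2 : ℂ)) else 0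

/-! ## The asymptotic secret fraction

The key bit `K` is Alice's outcome of a `Z`-measurement, `K_i` is the outcome of Bob `i`. -/

/-- `Q_Z`: the probability that at least one Bob has a `Z`-outcome different from Alice's. -/
def errZ {m : ℕ} (σ : QOp (PartyQubit m)) : ℝ :=
  ∑ x : PartyQubit m → Bool, if (∃ i, x (some i) ≠ x none) then (σ x x).re else 0

/-- `Q_{AB_i}`: the probability that the `Z`-outcome of Bob `i` differs from Alice's. -/
def errAB {m : ℕ} (σ : QOp (PartyQubit m)) (i : Fin m) : ℝ :=
  ∑ x : PartyQubit m → Bool, if x (some i) ≠ x none then (σ x x).re else 0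

/-- The Pauli operators `X` and `Y`. -/
def pauliX (a b : Bool) : ℂ := if a = b then 0 else 1

def pauliY (a b : Bool) : ℂ := if a = b then 0 else if a then Complex.I else -Complex.I

/-- The product measurement in which the parties `t` with `y t = true` measure `Y` and the others
measure `X`. -/
def pauliXY {m : ℕ} (y : PartyQubit m → Bool) : QOp (PartyQubit m) :=
  Matrix.of fun a b => ∏ t, if y t then pauliY (a t) (b t) else pauliX (a t) (b t)

/-- Number of parties that measure `Y`. -/
def numY {m : ℕ} (y : PartyQubit m → Bool) : ℕ := (Finset.univ.filter fun t => y t = true).card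

/-- The expectation value of `X ⊗ ⋯ ⊗ X` after depolarisation, as obtained from the second-type
measurements: the average over the `2 ^ m` settings with an even number `κ` of `Y`-measurements,
with sign `+` if `4 ∣ κ` and `-` otherwise. -/
def depolarisedX {m : ℕ} (σ : QOp (PartyQubit m)) : ℝ :=
  (∑ y : PartyQubit m → Bool,
    if Even (numY y) then (-1 : ℝ) ^ (numY y / 2) * (Matrix.trace (σ * pauliXY y)).re else 0)
    / 2 ^ m

/-- `Q_X`: the probability of an unexpected result of the `X`-measurement. -/
def errX {m : ℕ} (σ : QOp (PartyQubit m)) : ℝ := (1 - depolarisedX σ) / 2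

/-- `σ` and `ρ` give the same result in the parameter estimation. -/
def SameParameters {m : ℕ} (σ ρ : QOp (PartyQubit m)) : Prop :=
  errZ σ = errZ ρ ∧ errX σ = errX ρ ∧ ∀ i, errAB σ i = errAB ρ i

/-- The state of Alice and the Bobs if the global pure state with Eve is `ψ`. -/
def honestState {m d : ℕ} (ψ : (PartyQubit m → Bool) × Fin d → ℂ) : QOp (PartyQubit m) :=
  Matrix.of fun x x' => ∑ e, ψ (x, e) * star (ψ (x', e))

/-- Eve's state. -/
def eveState {m d : ℕ} (ψ : (PartyQubit m → Bool) × Fin d → ℂ) : Matrix (Fin d) (Fin d) ℂ :=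
  Matrix.of fun e e' => ∑ x, ψ (x, e) * star (ψ (x, e'))

/-- A bitwise preprocessing channel `U ← K`: `w k u` is the probability of `u` given `k`. -/
def IsBitChannel (w : Bool → Bool → ℝ) : Prop :=
  (∀ k u, 0 ≤ w k u) ∧ ∀ k, ∑ u, w k u = 1

/-- The joint state of the classical bit `U` and Eve. -/
def bitEveState {m d : ℕ} (w : Bool → Bool → ℝ) (ψ : (PartyQubit m → Bool) × Fin d → ℂ) :
    Matrix (Bool × Fin d) (Bool × Fin d) ℂ :=
  Matrix.of fun p p' =>
    if p.1 = p'.1 then ∑ x, (w (x none) p.1 : ℂ) * (ψ (x, p.2) * star (ψ (x, p'.2))) else 0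

/-- The conditional von Neumann entropy `S(U|E)`. -/
def condEntropyEve {m d : ℕ} (w : Bool → Bool → ℝ)
    (ψ : (PartyQubit m → Bool) × Fin d → ℂ) : ℝ :=
  vonNeumannEntropy (bitEveState w ψ) - vonNeumannEntropy (eveState ψ)

/-- The joint distribution of `U` and the `Z`-outcome `K_i` of Bob `i`. -/
def bitBobDist {m : ℕ} (w : Bool → Bool → ℝ) (σ : QOp (PartyQubit m)) (i : Fin m) :
    Bool × Bool → ℝ :=
  fun p => ∑ x : PartyQubit m → Bool, if x (some i) = p.2 then w (x none) p.1 * (σ x x).re else 0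

/-- The conditional Shannon entropy `H(U|K_i)`. -/
def condEntropyBob {m : ℕ} (w : Bool → Bool → ℝ) (σ : QOp (PartyQubit m)) (i : Fin m) : ℝ :=
  shannonEntropy (bitBobDist w σ i) - shannonEntropy fun b => ∑ u, bitBobDist w σ i (u, b)

/-- The asymptotic secret fraction
`r_∞ = sup_{U ← K} inf_{σ ∈ Γ} [S(U|E) - max_i H(U|K_i)]` of `m + 1` parties sharing `ρ`, where `Γ`
is the set of states that agree with `ρ` in the parameter estimation, and Eve holds a purification
of `σ`. -/
def secretFraction {m : ℕ} (ρ : QOp (PartyQubit m)) : ℝ :=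
  sSup {r : ℝ | ∃ w : Bool → Bool → ℝ, IsBitChannel w ∧
    r = sInf {s : ℝ | ∃ (d : ℕ) (ψ : (PartyQubit m → Bool) × Fin d → ℂ),
      (∑ p, ‖ψ p‖ ^ 2 = 1) ∧ SameParameters (honestState ψ) ρ ∧
      s = condEntropyEve w ψ - ⨆ i : Fin m, condEntropyBob w (honestState ψ) i}}

/-! ## Key rates in the router network -/

/-- The two qubits of the `i`-th pair, seen as the qubits of Alice and a single Bob. -/
def pairEmb (m : ℕ) (i : Fin m) : PartyQubit 1 ↪ PairQubit m where
  toFun t := (i, t.isSome)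
  inj' := by
    intro s t h
    have h' : s.isSome = t.isSome := congrArg Prod.snd h
    cases s with
    | none => cases t with
      | none => rfl
      | some _ => simp at h'
    | some a => cases t with
      | none => simp at h'
      | some b => rw [Subsingleton.elim a b]

/-- Secret fraction of the multipartite protocol in the ideal case: the parties share GHZ states. -/
def secretFractionNQKD (m : ℕ) : ℝ := secretFraction (pureState (ghz m))

/-- Secret fraction of the bipartite protocol in the ideal case: Alice establishes a key with each
Bob by means of the Bell pair shared with him; the conference key is sent encrypted with each of
these keys, so its length is the length of the shortest of them. -/
def secretFraction2QKD (m : ℕ) : ℝ :=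
  ⨅ i : Fin m, secretFraction (reduce (pairEmb m i) (pureState (bellPairs m)))

/-- Numbers of network uses with which the GHZ state can be distributed to Alice and the Bobs. -/
def usesNQKD (cc : Bool) (m : ℕ) : Set ℕ :=
  {n | DistributesInUses (chanSrc m) (chanTgt m) cc n (partyLoc m) (pureState (ghz m))}

/-- Numbers of network uses with which one Bell pair for Alice and each Bob can be distributed. -/
def uses2QKD (cc : Bool) (m : ℕ) : Set ℕ :=
  {n | DistributesInUses (chanSrc m) (chanTgt m) cc n (pairLoc m) (pureState (bellPairs m))}

/-- The key rate `R = r_∞ / t_rep`, where the time of a round is the smallest number of network uses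
that distributes the resource state of the round (one network use per unit of time). -/
def keyRateNQKD (cc : Bool) (m : ℕ) : ℝ := secretFractionNQKD m / (sInf (usesNQKD cc m) : ℕ)

def keyRate2QKD (cc : Bool) (m : ℕ) : ℝ := secretFraction2QKD m / (sInf (uses2QKD cc m) : ℕ)

end

end ConferenceQKD

open ConferenceQKD

/-!
Tracing out a qubit changes the von Neumann entropy by at most one bit: measuring in an eigenbasis
of the reduced state can only raise the entropy, and the remaining inequality is classical. Passing
to the complementary side of a pure state gives the other direction.

The Schmidt number of a mixed state across a cut is at most `r` if the state is a mixture of pure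
states of Schmidt rank at most `r`. Local operations and classical communication do not raise it,
and a qubit sent across the cut at most doubles it. So after `k` transmissions the reduced state of
a distributed pure state has rank at most `2 ^ k` and entropy at most `k`, whereas `N - 1` Bell
pairs have entropy `N - 1`. Conversely, a single network use suffices for the GHZ state: Alice sends
half of a Bell pair, which the router fans out by controlled negations and forwards to the Bobs.

Since `X ± iY` has a single nonzero entry, the averaged `X`/`Y` correlation of a state is its
coherence between `|0…0⟩` and `|1…1⟩`, which is maximal only for the GHZ state. Every state with the
ideal error rates therefore factors as the GHZ state times a pure state of Eve, and the quantity to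
be optimised is the mutual information between a fair bit and its image under the bit channel. This
is at most `1`, with equality for the identity channel.
-/

namespace ConferenceQKD

open Classical ComplexOrder

open scoped Kronecker

/-! ## Entropy -/

section Shannon

theorem sum_negMulLog_le {ι : Type*} {s : Finset ι} {p : ι → ℝ} (hp : ∀ i ∈ s, 0 ≤ p i) :
    ∑ i ∈ s, Real.negMulLog (p i) ≤
      Real.negMulLog (∑ i ∈ s, p i) + (∑ i ∈ s, p i) * Real.log s.card := by
  rcases s.eq_empty_or_nonempty with rfl | hs
  · simp
  have hc : (0 : ℝ) < s.card := by exact_mod_cast hs.card_pos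
  have jensen := Real.concaveOn_negMulLog.le_map_sum (t := s) (w := fun _ => (s.card : ℝ)⁻¹)
    (fun _ _ => by positivity) (by simp [hc.ne']) hp
  simp only [smul_eq_mul, ← Finset.mul_sum] at jensen
  rw [Real.negMulLog_mul, Real.negMulLog, Real.log_inv, inv_mul_le_iff₀ hc] at jensen
  calc _ ≤ _ := jensen
    _ = _ := by field_simp; ring

theorem negMulLog_sum_le {ι : Type*} {s : Finset ι} {p : ι → ℝ} (hp : ∀ i ∈ s, 0 ≤ p i) :
    Real.negMulLog (∑ i ∈ s, p i) ≤ ∑ i ∈ s, Real.negMulLog (p i) := by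
  simp only [Real.negMulLog, neg_mul, Finset.sum_neg_distrib, Finset.sum_mul]
  refine neg_le_neg (Finset.sum_le_sum fun i hi => ?_)
  obtain h0 | h0 := (hp i hi).eq_or_lt
  · simp [← h0]
  · exact mul_le_mul_of_nonneg_left
      (Real.log_le_log h0 (Finset.single_le_sum hp hi)) h0.le

variable {ι κ : Type} [Fintype ι] [Fintype κ]

theorem shannonEntropy_marginal_le {d : ι × κ → ℝ} (hd : ∀ p, 0 ≤ d p) :
    shannonEntropy (fun k => ∑ i, d (i, k)) ≤ shannonEntropy d := by
  refine div_le_div_of_nonneg_right ?_ (Real.log_nonneg one_le_two)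
  rw [Fintype.sum_prod_type_right]
  exact Finset.sum_le_sum fun k _ => negMulLog_sum_le fun i _ => hd (i, k)

theorem shannonEntropy_le_marginal_add {d : ι × κ → ℝ} (hd : ∀ p, 0 ≤ d p) :
    shannonEntropy d ≤
      shannonEntropy (fun i => ∑ k, d (i, k)) + (∑ p, d p) * Real.logb 2 (Fintype.card κ) := by
  rw [shannonEntropy, shannonEntropy, Real.logb, mul_div_assoc', ← add_div]
  refine div_le_div_of_nonneg_right ?_ (Real.log_nonneg one_le_two)
  rw [Fintype.sum_prod_type, Fintype.sum_prod_type, Finset.sum_mul, ← Finset.sum_add_distrib]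
  exact Finset.sum_le_sum fun i _ => sum_negMulLog_le fun k _ => hd (i, k)

theorem shannonEntropy_le_logb {p : ι → ℝ} (hp : ∀ i, 0 ≤ p i) (hp1 : ∑ i, p i = 1) {r : ℕ}
    (hr : Fintype.card {i // p i ≠ 0} ≤ r) : shannonEntropy p ≤ Real.logb 2 r := by
  set s : Finset ι := Finset.univ.filter fun i => p i ≠ 0
  have hs : ∑ i ∈ s, p i = 1 := by rw [Finset.sum_filter_ne_zero, hp1]
  have hcard : 0 < s.card :=
    Finset.card_pos.mpr (Finset.nonempty_of_sum_ne_zero (hs.trans_ne one_ne_zero))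
  have hsum : ∑ i, Real.negMulLog (p i) = ∑ i ∈ s, Real.negMulLog (p i) := by
    refine (Finset.sum_filter_of_ne fun i _ h => ?_).symm
    contrapose! h
    rw [h, Real.negMulLog_zero]
  refine div_le_div_of_nonneg_right ?_ (Real.log_nonneg one_le_two)
  calc _ ≤ Real.log s.card := by
        simpa [hsum, hs] using sum_negMulLog_le (s := s) fun i _ => hp i
    _ ≤ Real.log r := by
        rw [Fintype.card_subtype] at hr
        exact Real.log_le_log (by exact_mod_cast hcard) (by exact_mod_cast hr)

end Shannon

section VonNeumann

variable {ι κ : Type} [Fintype ι] [Fintype κ]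

theorem vonNeumannEntropy_of_isHermitian [inst : DecidableEq ι] {ρ : Matrix ι ι ℂ}
    (h : ρ.IsHermitian) : vonNeumannEntropy ρ = shannonEntropy h.eigenvalues := by
  obtain rfl : inst = fun a b => Classical.propDecidable (a = b) := Subsingleton.elim _ _
  rw [vonNeumannEntropy, dif_pos h]

theorem vonNeumannEntropy_eq_sum_roots [DecidableEq ι] {ρ : Matrix ι ι ℂ} (h : ρ.IsHermitian) :
    vonNeumannEntropy ρ =
      (ρ.charpoly.roots.map fun z : ℂ => Real.negMulLog z.re).sum / Real.log 2 := by
  rw [vonNeumannEntropy_of_isHermitian h, h.roots_charpoly_eq_eigenvalues, Multiset.map_map]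
  simp [shannonEntropy, Function.comp_def]

theorem vonNeumannEntropy_mul_comm {A : Matrix ι κ ℂ} {B : Matrix κ ι ℂ}
    (hAB : (A * B).IsHermitian) (hBA : (B * A).IsHermitian) :
    vonNeumannEntropy (A * B) = vonNeumannEntropy (B * A) := by
  have hroots := congrArg Polynomial.roots (Matrix.charpoly_mul_comm' A B)
  have hne {n : ℕ} {p : Polynomial ℂ} (hp : p.Monic) : Polynomial.X ^ n * p ≠ 0 :=
    ((Polynomial.monic_X_pow n).mul hp).ne_zero
  rw [Polynomial.roots_mul (hne (Matrix.charpoly_monic _)),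
    Polynomial.roots_mul (hne (Matrix.charpoly_monic _)), Polynomial.roots_X_pow,
    Polynomial.roots_X_pow] at hroots
  have hsum := congrArg (fun s => (s.map fun z : ℂ => Real.negMulLog z.re).sum) hroots
  simp only [Multiset.map_add, Multiset.sum_add, Multiset.map_nsmul, Multiset.sum_nsmul,
    Multiset.map_singleton, Multiset.sum_singleton, Complex.zero_re, Real.negMulLog_zero,
    smul_zero, zero_add] at hsum
  rw [vonNeumannEntropy_eq_sum_roots hAB, vonNeumannEntropy_eq_sum_roots hBA, hsum]

theorem vonNeumannEntropy_diagonal [DecidableEq ι] (d : ι → ℝ) :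
    vonNeumannEntropy (Matrix.diagonal fun i => (d i : ℂ)) = shannonEntropy d := by
  have h : (Matrix.diagonal fun i => (d i : ℂ)).IsHermitian :=
    Matrix.isHermitian_diagonal_iff.mpr fun i => Complex.conj_ofReal _
  rw [vonNeumannEntropy_eq_sum_roots h, Matrix.charpoly_diagonal, Polynomial.roots_prod _ _
    (Finset.prod_ne_zero_iff.mpr fun i _ => Polynomial.X_sub_C_ne_zero _)]
  simp [shannonEntropy]

theorem vonNeumannEntropy_submatrix_equiv (e : κ ≃ ι) {ρ : Matrix ι ι ℂ} (h : ρ.IsHermitian) :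
    vonNeumannEntropy (ρ.submatrix e e) = vonNeumannEntropy ρ := by
  rw [vonNeumannEntropy_eq_sum_roots h, vonNeumannEntropy_eq_sum_roots (h.submatrix e),
    ← Matrix.charpoly_reindex e.symm ρ, Matrix.reindex_apply, Equiv.symm_symm]

theorem vonNeumannEntropy_transpose {ρ : Matrix ι ι ℂ} (h : ρ.IsHermitian) :
    vonNeumannEntropy ρᵀ = vonNeumannEntropy ρ := by
  rw [vonNeumannEntropy_eq_sum_roots h, vonNeumannEntropy_eq_sum_roots h.transpose,
    Matrix.charpoly_transpose]

theorem vonNeumannEntropy_conj_unitary [DecidableEq ι] {ρ U : Matrix ι ι ℂ} (h : ρ.IsHermitian)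
    (hU : U ∈ Matrix.unitaryGroup ι ℂ) :
    vonNeumannEntropy (Uᴴ * ρ * U) = vonNeumannEntropy ρ := by
  have hcancel : U * (Uᴴ * ρ) = ρ := by
    rw [← Matrix.mul_assoc, ← Matrix.star_eq_conjTranspose, Matrix.mem_unitaryGroup_iff.mp hU,
      Matrix.one_mul]
  rw [vonNeumannEntropy_mul_comm (Matrix.isHermitian_conjTranspose_mul_mul _ h)
    (hcancel.symm ▸ h), hcancel]

theorem sum_norm_sq_row [DecidableEq ι] {U : Matrix ι ι ℂ} (hU : U ∈ Matrix.unitaryGroup ι ℂ)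
    (i : ι) : ∑ j, ‖U i j‖ ^ 2 = 1 := by
  have h := congrFun (congrFun (Matrix.mem_unitaryGroup_iff.mp hU) i) i
  simp only [Matrix.mul_apply, Matrix.star_apply, Complex.star_def, Complex.mul_conj',
    Matrix.one_apply_eq] at h
  exact_mod_cast h

theorem sum_norm_sq_col [DecidableEq ι] {U : Matrix ι ι ℂ} (hU : U ∈ Matrix.unitaryGroup ι ℂ)
    (j : ι) : ∑ i, ‖U i j‖ ^ 2 = 1 := by
  simpa using sum_norm_sq_row (Unitary.star_mem hU) j

theorem re_diag_eq_sum_eigenvalues [DecidableEq ι] {ρ : Matrix ι ι ℂ} (h : ρ.IsHermitian) (i : ι) :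
    (ρ i i).re = ∑ j, ‖h.eigenvectorUnitary.1 i j‖ ^ 2 * h.eigenvalues j := by
  have spectral : ρ = h.eigenvectorUnitary.1 *
      Matrix.diagonal (fun j => (h.eigenvalues j : ℂ)) * (h.eigenvectorUnitary.1)ᴴ :=
    h.spectral_theorem
  have hi := congrFun (congrFun spectral i) i
  simp only [Matrix.mul_apply (M := _ * _), Matrix.mul_diagonal, Matrix.conjTranspose_apply,
    mul_right_comm _ (Complex.ofReal _), Complex.star_def, Complex.mul_conj'] at hi
  rw [hi]
  norm_cast

theorem vonNeumannEntropy_le_diag {ρ : Matrix ι ι ℂ} (h : ρ.PosSemidef) :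
    vonNeumannEntropy ρ ≤ shannonEntropy fun i => (ρ i i).re := by
  have hU := h.isHermitian.eigenvectorUnitary.2
  set U := h.isHermitian.eigenvectorUnitary.1
  set μ := h.isHermitian.eigenvalues
  rw [vonNeumannEntropy_of_isHermitian h.isHermitian]
  refine div_le_div_of_nonneg_right ?_ (Real.log_nonneg one_le_two)
  calc ∑ j, Real.negMulLog (μ j)
      = ∑ j, (∑ i, ‖U i j‖ ^ 2) * Real.negMulLog (μ j) := by simp [sum_norm_sq_col hU]
    _ = ∑ i, ∑ j, ‖U i j‖ ^ 2 * Real.negMulLog (μ j) := by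
        simp_rw [Finset.sum_mul]
        exact Finset.sum_comm
    _ ≤ ∑ i, Real.negMulLog (∑ j, ‖U i j‖ ^ 2 * μ j) := by
        refine Finset.sum_le_sum fun i _ => ?_
        exact Real.concaveOn_negMulLog.le_map_sum (fun j _ => by positivity)
          (sum_norm_sq_row hU i) fun j _ => h.eigenvalues_nonneg j
    _ = _ := by simp only [re_diag_eq_sum_eigenvalues h.isHermitian, U, μ]

theorem vonNeumannEntropy_le_logb_rank {ρ : Matrix ι ι ℂ} (h : ρ.PosSemidef)
    (htrace : ρ.trace = 1) {r : ℕ} (hr : ρ.rank ≤ r) : vonNeumannEntropy ρ ≤ Real.logb 2 r := by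
  rw [vonNeumannEntropy_of_isHermitian h.isHermitian]
  refine shannonEntropy_le_logb h.eigenvalues_nonneg ?_ ?_
  · have hsum := h.isHermitian.trace_eq_sum_eigenvalues
    rw [htrace] at hsum
    exact Complex.ofReal_injective (by simpa using hsum.symm)
  · rwa [← h.isHermitian.rank_eq_card_non_zero_eigs]

end VonNeumann

section PartialTrace

variable {ι κ : Type} [Fintype κ]

/-- The partial trace of an operator on a bipartite system over the second factor. -/
def partialTrace (σ : Matrix (ι × κ) (ι × κ) ℂ) : Matrix ι ι ℂ :=
  Matrix.of fun i j => ∑ k, σ (i, k) (j, k)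

theorem isHermitian_partialTrace {σ : Matrix (ι × κ) (ι × κ) ℂ} (h : σ.IsHermitian) :
    (partialTrace σ).IsHermitian := by
  ext i j
  simp only [partialTrace, Matrix.conjTranspose_apply, Matrix.of_apply, star_sum, h.apply]

theorem posSemidef_partialTrace {σ : Matrix (ι × κ) (ι × κ) ℂ} (h : σ.PosSemidef) :
    (partialTrace σ).PosSemidef := by
  have hsum : partialTrace σ = ∑ k, σ.submatrix (·, k) (·, k) := by
    ext i j
    simp [partialTrace, Matrix.sum_apply]
  exact hsum ▸ Matrix.posSemidef_sum _ fun k _ => h.submatrix _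

variable [Fintype ι]

theorem trace_partialTrace (σ : Matrix (ι × κ) (ι × κ) ℂ) :
    (partialTrace σ).trace = σ.trace := by
  simp [Matrix.trace, partialTrace, Fintype.sum_prod_type]

theorem partialTrace_conj_kronecker_one [DecidableEq κ] (σ : Matrix (ι × κ) (ι × κ) ℂ)
    (U : Matrix ι ι ℂ) :
    partialTrace ((U ⊗ₖ (1 : Matrix κ κ ℂ))ᴴ * σ * (U ⊗ₖ (1 : Matrix κ κ ℂ))) =
      Uᴴ * partialTrace σ * U := by
  ext i j
  simp only [partialTrace, Matrix.of_apply, Matrix.mul_apply, Matrix.conjTranspose_apply,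
    Matrix.kroneckerMap_apply, Fintype.sum_prod_type, Matrix.one_apply, mul_ite, mul_one, mul_zero,
    apply_ite (star : ℂ → ℂ), star_zero, ite_mul, zero_mul, Finset.sum_ite_eq', Finset.mem_univ,
    if_true, Finset.sum_mul, Finset.mul_sum]
  rw [Finset.sum_comm]
  refine Finset.sum_congr rfl fun y _ => Finset.sum_comm

theorem vonNeumannEntropy_le_partialTrace_add {σ : Matrix (ι × κ) (ι × κ) ℂ}
    (h : σ.PosSemidef) :
    vonNeumannEntropy σ ≤
      vonNeumannEntropy (partialTrace σ) + σ.trace.re * Real.logb 2 (Fintype.card κ) := by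
  -- Measuring the first factor in an eigenbasis of its reduced state keeps the marginal spectrum.
  have hτ := isHermitian_partialTrace h.isHermitian
  set U := hτ.eigenvectorUnitary.1
  have hU : U ∈ Matrix.unitaryGroup ι ℂ := hτ.eigenvectorUnitary.2
  set W := U ⊗ₖ (1 : Matrix κ κ ℂ)
  have hW : W ∈ Matrix.unitaryGroup (ι × κ) ℂ :=
    Matrix.kronecker_mem_unitary hU (one_mem _)
  set σ' := Wᴴ * σ * W
  have hσ' : σ'.PosSemidef := h.conjTranspose_mul_mul_same W
  have hmarginal (i : ι) : ∑ k, (σ' (i, k) (i, k)).re = hτ.eigenvalues i := by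
    have hdiag : partialTrace σ' = Matrix.diagonal fun j => (hτ.eigenvalues j : ℂ) := by
      rw [partialTrace_conj_kronecker_one]
      exact (Unitary.conjStarAlgAut_star_apply _ _).symm.trans
        hτ.conjStarAlgAut_star_eigenvectorUnitary
    have := congrArg Complex.re (congrFun (congrFun hdiag i) i)
    rwa [Matrix.diagonal_apply_eq, Complex.ofReal_re, partialTrace, Matrix.of_apply,
      Complex.re_sum] at this
  have htrace : ∑ p, (σ' p p).re = σ.trace.re := by
    rw [← Complex.re_sum]
    change (Matrix.trace (Wᴴ * σ * W)).re = _
    rw [Matrix.trace_mul_cycle, ← Matrix.star_eq_conjTranspose,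
      Matrix.mem_unitaryGroup_iff.mp hW, Matrix.one_mul]
  calc vonNeumannEntropy σ = vonNeumannEntropy σ' :=
        (vonNeumannEntropy_conj_unitary h.isHermitian hW).symm
    _ ≤ shannonEntropy fun p => (σ' p p).re := vonNeumannEntropy_le_diag hσ'
    _ ≤ _ := shannonEntropy_le_marginal_add fun p => (Complex.le_def.mp hσ'.diag_nonneg).1
    _ = _ := by simp only [hmarginal, htrace, vonNeumannEntropy_of_isHermitian hτ]

end PartialTrace

section PureState

variable {ι κ : Type}

theorem pureState_eq_vecMulVec (ψ : ι → ℂ) : pureState ψ = Matrix.vecMulVec ψ (star ψ) := rfl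

theorem isHermitian_pureState (ψ : ι → ℂ) : (pureState ψ).IsHermitian := by
  ext i j
  simp [pureState, mul_comm]

theorem posSemidef_pureState [Finite ι] (ψ : ι → ℂ) : (pureState ψ).PosSemidef :=
  Matrix.posSemidef_vecMulVec_self_star ψ

variable [Fintype ι]

theorem mul_pureState_mul_conjTranspose (K : Matrix κ ι ℂ) (ψ : ι → ℂ) :
    K * pureState ψ * Kᴴ = pureState (K *ᵥ ψ) := by
  rw [pureState_eq_vecMulVec, Matrix.mul_vecMulVec, Matrix.vecMulVec_mul, ← Matrix.star_mulVec,
    pureState_eq_vecMulVec]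

theorem trace_pureState (ψ : ι → ℂ) : (pureState ψ).trace = ((∑ x, ‖ψ x‖ ^ 2 : ℝ) : ℂ) := by
  simp [Matrix.trace, pureState, Complex.mul_conj']

variable [Fintype κ]

theorem vonNeumannEntropy_kronecker_pureState {ρ : Matrix ι ι ℂ} (h : ρ.IsHermitian) {v : κ → ℂ}
    (hv : ∑ k, ‖v k‖ ^ 2 = 1) : vonNeumannEntropy (ρ ⊗ₖ pureState v) = vonNeumannEntropy ρ := by
  set ket := Matrix.replicateCol Unit v
  have hket : pureState v = ket * ketᴴ := by
    rw [Matrix.conjTranspose_replicateCol, ← Matrix.vecMulVec_eq, pureState_eq_vecMulVec]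
  have hbraket : ketᴴ * ket = 1 := by
    ext
    simpa [ket, Matrix.mul_apply, Complex.conj_mul'] using congrArg Complex.ofReal hv
  have hfactor : ρ ⊗ₖ pureState v = (ρ ⊗ₖ ket) * ((1 : Matrix ι ι ℂ) ⊗ₖ ketᴴ) := by
    rw [← Matrix.mul_kronecker_mul, Matrix.mul_one, hket]
  have hswap : ((1 : Matrix ι ι ℂ) ⊗ₖ ketᴴ) * (ρ ⊗ₖ ket) =
      ρ.submatrix (Equiv.prodUnique ι Unit) (Equiv.prodUnique ι Unit) := by
    rw [← Matrix.mul_kronecker_mul, Matrix.one_mul, hbraket]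
    ext i j
    simp
  rw [hfactor, vonNeumannEntropy_mul_comm, hswap, vonNeumannEntropy_submatrix_equiv _ h]
  · rw [← hfactor, Matrix.IsHermitian, Matrix.conjTranspose_kronecker, h.eq,
      (isHermitian_pureState v).eq]
  · exact hswap ▸ h.submatrix _

theorem vonNeumannEntropy_pureState {v : κ → ℂ} (hv : ∑ k, ‖v k‖ ^ 2 = 1) :
    vonNeumannEntropy (pureState v) = 0 := by
  have hunit : pureState v = ((Matrix.diagonal fun _ : Unit => ((1 : ℝ) : ℂ)) ⊗ₖ
      pureState v).submatrix (Equiv.uniqueProd κ Unit).symm (Equiv.uniqueProd κ Unit).symm := by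
    ext i j
    simp
  have hdiag : (Matrix.diagonal fun _ : Unit => ((1 : ℝ) : ℂ)).IsHermitian :=
    Matrix.isHermitian_diagonal_iff.mpr fun _ => Complex.conj_ofReal _
  rw [hunit, vonNeumannEntropy_submatrix_equiv, vonNeumannEntropy_kronecker_pureState hdiag hv,
    vonNeumannEntropy_diagonal]
  · simp [shannonEntropy]
  · rw [Matrix.IsHermitian, Matrix.conjTranspose_kronecker, hdiag.eq,
      (isHermitian_pureState v).eq]

end PureState

/-! ## Registers and cuts -/

section Cut

variable {Q T E : Type}

/-- Basis states of a register that is split by `s` into two parts are pairs of basis states of the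
parts. -/
def joinEquiv (s : T ⊕ E ≃ Q) : (T → Bool) × (E → Bool) ≃ (Q → Bool) :=
  (Equiv.sumArrowEquivProdArrow T E Bool).symm.trans (s.arrowCongr (Equiv.refl Bool))

@[simp]
theorem joinEquiv_inl (s : T ⊕ E ≃ Q) (p : (T → Bool) × (E → Bool)) (t : T) :
    joinEquiv s p (s (Sum.inl t)) = p.1 t := by
  simp [joinEquiv, Equiv.sumArrowEquivProdArrow]

@[simp]
theorem joinEquiv_inr (s : T ⊕ E ≃ Q) (p : (T → Bool) × (E → Bool)) (e : E) :
    joinEquiv s p (s (Sum.inr e)) = p.2 e := by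
  simp [joinEquiv, Equiv.sumArrowEquivProdArrow]

theorem joinEquiv_eq_iff (s : T ⊕ E ≃ Q) (p : (T → Bool) × (E → Bool)) (x : Q → Bool) :
    joinEquiv s p = x ↔ (∀ t, p.1 t = x (s (Sum.inl t))) ∧ ∀ e, p.2 e = x (s (Sum.inr e)) := by
  rw [funext_iff, ← s.forall_congr_right, Sum.forall]
  simp

theorem zeroVec_joinEquiv (s : T ⊕ E ≃ Q) (a : T → Bool) (e : E → Bool) :
    zeroVec Q (joinEquiv s (a, e)) =
      if a = fun _ => false then (if e = fun _ => false then 1 else 0) else 0 := by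
  simp only [zeroVec, joinEquiv_eq_iff, ← funext_iff, ite_and]

/-- The splitting of a register into the qubits singled out by `τ` and the other ones. -/
noncomputable def complEquiv (τ : T ↪ Q) : T ⊕ ↥(Set.range τ)ᶜ ≃ Q :=
  ((Equiv.ofInjective τ τ.injective).sumCongr (Equiv.refl _)).trans
    (Equiv.Set.sumCompl (Set.range τ))

@[simp]
theorem complEquiv_inl (τ : T ↪ Q) (t : T) : complEquiv τ (Sum.inl t) = τ t := rfl

variable [Fintype Q] [Fintype E] [DecidableEq E]

theorem reduce_eq_partialTrace {τ : T ↪ Q} {s : T ⊕ E ≃ Q} (h : ∀ t, s (Sum.inl t) = τ t)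
    (ρ : QOp Q) : reduce τ ρ = partialTrace (ρ.submatrix (joinEquiv s) (joinEquiv s)) := by
  let _ := Fintype.ofInjective τ τ.injective
  have hrange (q : Q) : q ∉ Set.range τ ↔ ∃ e, s (Sum.inr e) = q := by
    obtain ⟨t | e, rfl⟩ := s.surjective q
    · simp [-Set.mem_range, show s (Sum.inl t) ∈ Set.range τ from ⟨t, (h t).symm⟩]
    · simp [← h]
  ext a a'
  simp only [reduce, partialTrace, Matrix.of_apply, Matrix.submatrix_apply, hrange,
    forall_exists_index, forall_apply_eq_imp_iff, ← h]
  have hsum (f : (Q → Bool) → ℂ) : ∑ x, f x = ∑ b, ∑ e, f (joinEquiv s (b, e)) := by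
    rw [← (joinEquiv s).sum_comp, Fintype.sum_prod_type]
  simp only [hsum, joinEquiv_inl, joinEquiv_inr, ← funext_iff, ite_and]
  simp

theorem posSemidef_reduce (τ : T ↪ Q) {ρ : QOp Q} (h : ρ.PosSemidef) :
    (reduce τ ρ).PosSemidef := by
  rw [reduce_eq_partialTrace (complEquiv_inl τ)]
  exact posSemidef_partialTrace (h.submatrix _)

theorem reduce_reduce {S : Type} [Fintype T] (τ : T ↪ Q) (τ' : S ↪ T) (ρ : QOp Q) :
    reduce τ' (reduce τ ρ) = reduce (τ'.trans τ) ρ := by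
  set s := complEquiv τ
  set s' := complEquiv τ'
  let r : S ⊕ (↥(Set.range τ')ᶜ ⊕ ↥(Set.range τ)ᶜ) ≃ Q :=
    (Equiv.sumAssoc _ _ _).symm.trans ((s'.sumCongr (Equiv.refl _)).trans s)
  have hjoin (a : S → Bool) (e' : ↥(Set.range τ')ᶜ → Bool) (e : ↥(Set.range τ)ᶜ → Bool) :
      joinEquiv r (a, Sum.elim e' e) = joinEquiv s (joinEquiv s' (a, e'), e) := by
    simp [joinEquiv_eq_iff, r]
  rw [reduce_eq_partialTrace (complEquiv_inl τ), reduce_eq_partialTrace (complEquiv_inl τ'),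
    reduce_eq_partialTrace (s := r) fun t => rfl]
  ext a a'
  simp only [partialTrace, Matrix.of_apply, Matrix.submatrix_apply]
  rw [← (Equiv.sumArrowEquivProdArrow _ _ Bool).symm.sum_comp, Fintype.sum_prod_type]
  exact Finset.sum_congr rfl fun e' _ => Finset.sum_congr rfl fun e _ => by
    exact (congrArg₂ ρ (hjoin a e' e) (hjoin a' e' e)).symm

/-- The amplitudes of a pure state as a matrix: rows are indexed by the basis states of the first
part of the register, columns by those of the second part. -/
def amplitudeMatrix (s : T ⊕ E ≃ Q) (ψ : (Q → Bool) → ℂ) : Matrix (T → Bool) (E → Bool) ℂ :=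
  Matrix.of fun a e => ψ (joinEquiv s (a, e))

theorem reduce_pureState {τ : T ↪ Q} {s : T ⊕ E ≃ Q} (h : ∀ t, s (Sum.inl t) = τ t)
    (ψ : (Q → Bool) → ℂ) :
    reduce τ (pureState ψ) = amplitudeMatrix s ψ * (amplitudeMatrix s ψ)ᴴ := by
  rw [reduce_eq_partialTrace h]
  ext a a'
  simp [partialTrace, amplitudeMatrix, pureState, Matrix.mul_apply]

variable [Fintype T] [DecidableEq T]

theorem trace_reduce (τ : T ↪ Q) (ρ : QOp Q) : (reduce τ ρ).trace = ρ.trace := by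
  rw [reduce_eq_partialTrace (complEquiv_inl τ), trace_partialTrace]
  exact (joinEquiv (complEquiv τ)).sum_comp fun x => ρ x x

theorem vonNeumannEntropy_le_reduce_add [hQ : DecidableEq Q] (τ : T ↪ Q) {ρ : QOp Q}
    (h : ρ.PosSemidef) :
    vonNeumannEntropy ρ ≤ vonNeumannEntropy (reduce τ ρ) +
      ρ.trace.re * (Fintype.card Q - Fintype.card T) := by
  obtain rfl : hQ = fun a b => Classical.propDecidable (a = b) := Subsingleton.elim _ _
  have hcard : (Fintype.card (↥(Set.range τ)ᶜ) : ℝ) = Fintype.card Q - Fintype.card T := by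
    rw [← Fintype.card_congr (complEquiv τ), Fintype.card_sum]
    push_cast
    ring
  have hbound := vonNeumannEntropy_le_partialTrace_add
    (h.submatrix (joinEquiv (complEquiv τ)))
  rwa [vonNeumannEntropy_submatrix_equiv _ h.isHermitian,
    ← reduce_eq_partialTrace (complEquiv_inl τ), ← trace_partialTrace,
    ← reduce_eq_partialTrace (complEquiv_inl τ), trace_reduce, Fintype.card_fun,
    Fintype.card_bool, Nat.cast_pow, Nat.cast_ofNat, Real.logb_pow,
    Real.logb_self_eq_one one_lt_two, mul_one, hcard] at hbound

theorem entanglementEntropy_eq_amplitudeMatrix {A : Finset Q} {s : T ⊕ E ≃ Q}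
    (hT : ∀ t, s (Sum.inl t) ∈ A) (hE : ∀ e, s (Sum.inr e) ∉ A) (ψ : (Q → Bool) → ℂ) :
    entanglementEntropy A ψ =
      vonNeumannEntropy (amplitudeMatrix s ψ * (amplitudeMatrix s ψ)ᴴ) := by
  let f : T ≃ {q // q ∈ A} := Equiv.ofBijective (fun t => ⟨s (Sum.inl t), hT t⟩) <| by
    refine ⟨fun t t' htt' => Sum.inl_injective (s.injective (congrArg Subtype.val htt')), ?_⟩
    rintro ⟨q, hq⟩
    obtain ⟨t | e, rfl⟩ := s.surjective q
    exacts [⟨t, rfl⟩, absurd hq (hE e)]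
  set s' : {q // q ∈ A} ⊕ E ≃ Q := (f.sumCongr (Equiv.refl E)).symm.trans s
  have hs' (q : {q // q ∈ A}) : s' (Sum.inl q) = Function.Embedding.subtype (· ∈ A) q :=
    congrArg Subtype.val (f.apply_symm_apply q)
  have hreindex : amplitudeMatrix s ψ =
      (amplitudeMatrix s' ψ).submatrix (f.arrowCongr (Equiv.refl Bool)) id := by
    ext a e
    refine congrArg ψ ((joinEquiv_eq_iff ..).mpr ⟨fun t => ?_, fun e' => ?_⟩)
    · simpa [s'] using (joinEquiv_inl s' (f.arrowCongr (Equiv.refl Bool) a, e) (f t)).symm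
    · simpa [s'] using (joinEquiv_inr s' (f.arrowCongr (Equiv.refl Bool) a, e) e').symm
  rw [entanglementEntropy, reduce_pureState hs', hreindex, Matrix.conjTranspose_submatrix,
    ← Matrix.submatrix_mul _ _ _ id _ Function.bijective_id, vonNeumannEntropy_submatrix_equiv]
  exact Matrix.isHermitian_mul_conjTranspose_self _

theorem entanglementEntropy_compl [DecidableEq Q] (A : Finset Q) (ψ : (Q → Bool) → ℂ) :
    entanglementEntropy Aᶜ ψ = entanglementEntropy A ψ := by
  set s := Equiv.sumCompl (· ∈ A)
  set M := amplitudeMatrix s ψ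
  have hswap : amplitudeMatrix ((Equiv.sumComm _ _).trans s) ψ = Mᵀ := by
    ext a e
    refine congrArg ψ ?_
    simp [joinEquiv_eq_iff]
  have hM : Mᵀ * Mᵀᴴ = (Mᴴ * M)ᵀ := by
    rw [Matrix.transpose_mul]
    rfl
  rw [entanglementEntropy_eq_amplitudeMatrix (A := Aᶜ) (s := (Equiv.sumComm _ _).trans s)
      (fun t => Finset.mem_compl.mpr t.2) (fun e => Finset.notMem_compl.mpr e.2),
    entanglementEntropy_eq_amplitudeMatrix (s := s) (fun t => t.2) (fun e => e.2), hswap, hM,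
    vonNeumannEntropy_transpose (Matrix.isHermitian_conjTranspose_mul_self M),
    vonNeumannEntropy_mul_comm (Matrix.isHermitian_conjTranspose_mul_self M)
      (Matrix.isHermitian_mul_conjTranspose_self M)]

theorem entanglementEntropy_le_add_card_sdiff [hQ : DecidableEq Q] {A B : Finset Q} (hBA : B ⊆ A)
    {ψ : (Q → Bool) → ℂ} (hψ : ∑ x, ‖ψ x‖ ^ 2 = 1) :
    entanglementEntropy A ψ ≤ entanglementEntropy B ψ + (A \ B).card := by
  obtain rfl : hQ = fun a b => Classical.propDecidable (a = b) := Subsingleton.elim _ _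
  have hbound := vonNeumannEntropy_le_reduce_add (Subtype.impEmbedding (· ∈ B) (· ∈ A) hBA)
    (posSemidef_reduce (Function.Embedding.subtype (· ∈ A)) (posSemidef_pureState ψ))
  rw [reduce_reduce, trace_reduce, trace_pureState, hψ] at hbound
  have hcard : ((A \ B).card : ℝ) = Fintype.card {q // q ∈ A} - Fintype.card {q // q ∈ B} := by
    rw [Finset.cast_card_sdiff hBA, Fintype.card_coe, Fintype.card_coe]
  rw [hcard]
  change entanglementEntropy A ψ ≤ entanglementEntropy B ψ + _ at hbound
  simpa using hbound

theorem entanglementEntropy_subset_le_add_card_sdiff [DecidableEq Q] {A B : Finset Q} (hBA : B ⊆ A)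
    {ψ : (Q → Bool) → ℂ} (hψ : ∑ x, ‖ψ x‖ ^ 2 = 1) :
    entanglementEntropy B ψ ≤ entanglementEntropy A ψ + (A \ B).card := by
  rw [← entanglementEntropy_compl A, ← entanglementEntropy_compl B, ← compl_sdiff_compl]
  exact entanglementEntropy_le_add_card_sdiff (Finset.compl_subset_compl.mpr hBA) hψ

theorem entanglementEntropy_erase_le [DecidableEq Q] {A : Finset Q} {q : Q} (hq : q ∈ A)
    {ψ : (Q → Bool) → ℂ} (hψ : ∑ x, ‖ψ x‖ ^ 2 = 1) :
    entanglementEntropy (A.erase q) ψ ≤ entanglementEntropy A ψ + 1 := by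
  simpa [Finset.sdiff_erase_self hq] using
    entanglementEntropy_subset_le_add_card_sdiff (A.erase_subset q) hψ

end Cut

section LocalOperator

theorem joinEquiv_sumCompl_apply {Q : Type} {p : Q → Prop} [DecidablePred p]
    (x : ({q // p q} → Bool) × ({q // ¬p q} → Bool)) (q : Q) :
    joinEquiv (Equiv.sumCompl p) x q = if h : p q then x.1 ⟨q, h⟩ else x.2 ⟨q, h⟩ := by
  by_cases h : p q
  · rw [dif_pos h, ← joinEquiv_inl (Equiv.sumCompl p), Equiv.sumCompl_apply_inl]
  · rw [dif_neg h, ← joinEquiv_inr (Equiv.sumCompl p), Equiv.sumCompl_apply_inr]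

variable {V Q : Type} [Fintype Q]

/-- The operator that acts as `A` on the qubits held by the node `v` and as the identity on all
others. -/
noncomputable def localOperator (o : Q → V) (v : V) (A : QOp {q // o q = v}) : QOp Q :=
  (A ⊗ₖ (1 : QOp {q // ¬o q = v})).submatrix (joinEquiv (Equiv.sumCompl (o · = v))).symm
    (joinEquiv (Equiv.sumCompl (o · = v))).symm

theorem localOperator_apply (o : Q → V) (v : V) (A : QOp {q // o q = v}) (x y : Q → Bool)
    [Decidable (∀ q, o q ≠ v → x q = y q)] :
    localOperator o v A x y =
      if ∀ q, o q ≠ v → x q = y q then A (fun q => x q) (fun q => y q) else 0 := by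
  have hrest : (fun q : {q // ¬o q = v} => x q) = (fun q : {q // ¬o q = v} => y q) ↔
      ∀ q, o q ≠ v → x q = y q := by
    simp [funext_iff]
  change A (fun q => x q) (fun q => y q) *
    (1 : QOp {q // ¬o q = v}) (fun q => x q) (fun q => y q) = _
  rw [Matrix.one_apply, mul_ite, mul_one, mul_zero]
  exact if_congr hrest rfl rfl

theorem isLocalAt_iff {o : Q → V} {v : V} {K : QOp Q} :
    IsLocalAt o v K ↔ ∃ A, K = localOperator o v A := by
  refine exists_congr fun A => ?_
  simp only [← Matrix.ext_iff]
  refine forall₂_congr fun x y => ?_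
  rw [localOperator_apply]
  congr!

theorem localOperator_mulVec_apply (o : Q → V) (v : V) (A : QOp {q // o q = v})
    (ψ : (Q → Bool) → ℂ) (a : {q // o q = v} → Bool) (e : {q // ¬o q = v} → Bool) :
    (localOperator o v A *ᵥ ψ) (joinEquiv (Equiv.sumCompl (o · = v)) (a, e)) =
      ∑ a', A a a' * ψ (joinEquiv (Equiv.sumCompl (o · = v)) (a', e)) := by
  rw [Matrix.mulVec, dotProduct, ← (joinEquiv (Equiv.sumCompl (o · = v))).sum_comp,
    Fintype.sum_prod_type]
  simp [localOperator, Matrix.one_apply]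

end LocalOperator

/-! ## Schmidt rank and Schmidt number -/

section SchmidtRank

variable {Q : Type}

/-- The amplitudes of a pure state as a matrix whose rows are indexed by the basis states of the
qubits in `S` and whose columns by those of the other qubits. To keep the index types independent of
`S`, both are encoded as basis states of the whole register, whose other entries are ignored. -/
noncomputable def cutMatrix (S : Set Q) (ψ : (Q → Bool) → ℂ) : Matrix (Q → Bool) (Q → Bool) ℂ :=
  Matrix.of fun x y => ψ (S.piecewise x y)

theorem cutMatrix_compl (S : Set Q) (ψ : (Q → Bool) → ℂ) :
    cutMatrix Sᶜ ψ = (cutMatrix S ψ)ᵀ := by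
  ext x y
  simp [cutMatrix, Set.piecewise_compl]

theorem rank_add_le {ι κ : Type} [Finite ι] [Fintype κ] (M N : Matrix ι κ ℂ) :
    (M + N).rank ≤ M.rank + N.rank := by
  rw [Matrix.rank, Matrix.mulVecLin_add]
  exact (Submodule.finrank_mono (LinearMap.range_add_le _ _)).trans
    (Submodule.finrank_add_le_finrank_add_finrank _ _)

variable [Fintype Q]

/-- The Schmidt rank of a pure state across the cut of the register into `S` and its complement. -/
noncomputable def schmidtRank (S : Set Q) (ψ : (Q → Bool) → ℂ) : ℕ := (cutMatrix S ψ).rank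

theorem schmidtRank_compl (S : Set Q) (ψ : (Q → Bool) → ℂ) :
    schmidtRank Sᶜ ψ = schmidtRank S ψ := by
  rw [schmidtRank, cutMatrix_compl, Matrix.rank_transpose, schmidtRank]

theorem schmidtRank_zeroVec_le (S : Set Q) : schmidtRank S (zeroVec Q) ≤ 1 := by
  have hprod : cutMatrix S (zeroVec Q) = Matrix.vecMulVec
      (fun x => if ∀ q ∈ S, x q = false then 1 else 0)
      (fun y => if ∀ q ∉ S, y q = false then 1 else 0) := by
    ext x y
    have hzero : (S.piecewise x y = fun _ => false) ↔
        (∀ q ∈ S, x q = false) ∧ ∀ q ∉ S, y q = false := by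
      simp only [funext_iff, Set.piecewise, ← forall_and]
      refine forall_congr' fun q => ?_
      by_cases hq : q ∈ S <;> simp [hq]
    simp [cutMatrix, zeroVec, hzero, Matrix.vecMulVec_apply, ← ite_and, and_comm]
  rw [schmidtRank, hprod]
  exact Matrix.rank_vecMulVec_le _ _

theorem schmidtRank_le_of_eq_smul {S : Set Q} {χ ψ : (Q → Bool) → ℂ} {c : ℂ} (h : ψ = c • χ) :
    schmidtRank S ψ ≤ schmidtRank S χ := by
  have hscale : cutMatrix S ψ = cutMatrix S χ * (c • 1) := by
    ext
    simp [cutMatrix, h]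
  rw [schmidtRank, hscale]
  exact Matrix.rank_mul_le_left _ _

theorem schmidtRank_comp_joinEquiv_le {T E : Type} [Fintype T] (s : T ⊕ E ≃ Q)
    (S : Set Q) (χ : (Q → Bool) → ℂ) (e : E → Bool) :
    schmidtRank {t | s (Sum.inl t) ∈ S} (fun a => χ (joinEquiv s (a, e))) ≤ schmidtRank S χ := by
  have hsub : cutMatrix {t | s (Sum.inl t) ∈ S} (fun a => χ (joinEquiv s (a, e))) =
      (cutMatrix S χ).submatrix (fun x => joinEquiv s (x, e)) (fun y => joinEquiv s (y, e)) := by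
    ext x y
    refine congrArg χ ((joinEquiv_eq_iff ..).mpr ⟨fun t => ?_, fun e' => ?_⟩)
    · by_cases ht : s (Sum.inl t) ∈ S <;> simp [Set.piecewise, ht]
    · simp [Set.piecewise]
  rw [schmidtRank, hsub]
  exact Matrix.rank_submatrix_le _ _ _

theorem schmidtRank_localOperator_mulVec_le_of_subset {V : Type} {o : Q → V} {v : V} {S : Set Q}
    (hS : ∀ q, o q = v → q ∈ S) (A : QOp {q // o q = v}) (ψ : (Q → Bool) → ℂ) :
    schmidtRank S (localOperator o v A *ᵥ ψ) ≤ schmidtRank S ψ := by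
  set s := Equiv.sumCompl (o · = v)
  have hmul : cutMatrix S (localOperator o v A *ᵥ ψ) = localOperator o v A * cutMatrix S ψ := by
    ext x y
    obtain ⟨⟨a, e⟩, rfl⟩ := (joinEquiv s).surjective x
    have hpiece (a' : {q // o q = v} → Bool) : S.piecewise (joinEquiv s (a', e)) y =
        joinEquiv s (a', fun q => S.piecewise (joinEquiv s (a, e)) y q) := by
      ext q
      by_cases hq : o q = v
      · simp [s, joinEquiv_sumCompl_apply, hq, hS q hq]
      · by_cases hqS : q ∈ S <;> simp [s, joinEquiv_sumCompl_apply, hq, hqS]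
    change (localOperator o v A *ᵥ ψ) (S.piecewise (joinEquiv s (a, e)) y) =
      (localOperator o v A *ᵥ fun x => ψ (S.piecewise x y)) (joinEquiv s (a, e))
    rw [hpiece, localOperator_mulVec_apply, localOperator_mulVec_apply]
    exact Finset.sum_congr rfl fun a' _ => by rw [hpiece a']
  rw [schmidtRank, hmul]
  exact Matrix.rank_mul_le_right _ _

theorem schmidtRank_mulVec_le {V : Type} {o : Q → V} {v : V} {K : QOp Q} (hK : IsLocalAt o v K)
    (P : Set V) (ψ : (Q → Bool) → ℂ) :
    schmidtRank (o ⁻¹' P) (K *ᵥ ψ) ≤ schmidtRank (o ⁻¹' P) ψ := by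
  obtain ⟨A, rfl⟩ := isLocalAt_iff.mp hK
  by_cases hv : v ∈ P
  · exact schmidtRank_localOperator_mulVec_le_of_subset (fun q hq => by simpa [hq]) A ψ
  · rw [← schmidtRank_compl, ← schmidtRank_compl _ ψ]
    exact schmidtRank_localOperator_mulVec_le_of_subset (fun q hq => by simpa [hq]) A ψ

theorem schmidtRank_le_two_mul {S S' : Set Q} {q : Q} (h : ∀ p ≠ q, (p ∈ S' ↔ p ∈ S))
    (ψ : (Q → Bool) → ℂ) : schmidtRank S' ψ ≤ 2 * schmidtRank S ψ := by
  -- Once the bit of `q` is fixed, it no longer matters on which side of the cut `q` lies.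
  let row (b : Bool) : Matrix (Q → Bool) (Q → Bool) ℂ :=
    Matrix.diagonal fun x => if q ∈ S' → x q = b then 1 else 0
  let col (b : Bool) : Matrix (Q → Bool) (Q → Bool) ℂ :=
    Matrix.diagonal fun y => if q ∉ S' → y q = b then 1 else 0
  let M (b : Bool) : Matrix (Q → Bool) (Q → Bool) ℂ :=
    (cutMatrix S ψ).submatrix (Function.update · q b) (Function.update · q b)
  have hM (x y : Q → Bool) (b : Bool) : M b x y = ψ (Function.update (S'.piecewise x y) q b) := by
    refine congrArg ψ (funext fun p => ?_)
    by_cases hp : p = q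
    · subst hp
      by_cases hpS : p ∈ S <;> simp [hpS]
    · by_cases hpS : p ∈ S <;> simp [hp, hpS, h p hp]
  have hselect (x y : Q → Bool) (b : Bool) : (row b * M b * col b) x y =
      if S'.piecewise x y q = b then cutMatrix S' ψ x y else 0 := by
    have hcoeff : (if q ∈ S' → x q = b then (1 : ℂ) else 0) *
        (if q ∉ S' → y q = b then 1 else 0) = if S'.piecewise x y q = b then 1 else 0 := by
      by_cases hq : q ∈ S' <;> simp [hq]
    rw [Matrix.mul_diagonal, Matrix.diagonal_mul, hM, mul_right_comm, hcoeff, ite_mul, one_mul,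
      zero_mul]
    split_ifs with hb
    · rw [← hb, Function.update_eq_self]
      rfl
    · rfl
  have hsum : cutMatrix S' ψ = row false * M false * col false + row true * M true * col true := by
    ext x y
    rw [Matrix.add_apply, hselect, hselect]
    cases S'.piecewise x y q <;> simp
  have hrank (b : Bool) : (row b * M b * col b).rank ≤ schmidtRank S ψ :=
    (Matrix.rank_mul_le_left _ _).trans <| (Matrix.rank_mul_le_right _ _).trans <|
      Matrix.rank_submatrix_le _ _ _
  calc schmidtRank S' ψ
      ≤ (row false * M false * col false).rank + (row true * M true * col true).rank := by
        rw [schmidtRank, hsum]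
        exact rank_add_le _ _
    _ ≤ 2 * schmidtRank S ψ := by linarith [hrank false, hrank true]

theorem entanglementEntropy_le_logb_of_schmidtRank_le {A : Finset Q} {ψ : (Q → Bool) → ℂ}
    (hψ : ∑ x, ‖ψ x‖ ^ 2 = 1) {r : ℕ} (hr : schmidtRank (A : Set Q) ψ ≤ r) :
    entanglementEntropy A ψ ≤ Real.logb 2 r := by
  set s := Equiv.sumCompl (· ∈ A)
  have hM : amplitudeMatrix s ψ = (cutMatrix (A : Set Q) ψ).submatrix
      (fun a => joinEquiv s (a, fun _ => false))
      (fun e => joinEquiv s (fun _ => false, e)) := by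
    ext a e
    refine congrArg ψ ((joinEquiv_eq_iff ..).mpr ⟨fun t => ?_, fun e' => ?_⟩)
    · simp [s, joinEquiv_sumCompl_apply]
    · have he' : s (Sum.inr e') ∉ (A : Set Q) := e'.2
      simp [he']
  have hred := reduce_pureState (τ := Function.Embedding.subtype (· ∈ A))
    (s := s) (fun _ => rfl) ψ
  refine vonNeumannEntropy_le_logb_rank (posSemidef_reduce _ (posSemidef_pureState ψ)) ?_ ?_
  · rw [trace_reduce, trace_pureState, hψ, Complex.ofReal_one]
  · rw [hred, Matrix.rank_self_mul_conjTranspose, hM]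
    exact (Matrix.rank_submatrix_le _ _ _).trans hr

end SchmidtRank

section SchmidtCone

variable {Q : Type} [Fintype Q]

/-- The operators of Schmidt number at most `r` across the cut of the register into `S` and its
complement: the sums of (unnormalised) pure states of Schmidt rank at most `r`. -/
def schmidtCone (S : Set Q) (r : ℕ) : AddSubmonoid (QOp Q) :=
  AddSubmonoid.closure (pureState '' {ψ | schmidtRank S ψ ≤ r})

theorem pureState_mem_schmidtCone {S : Set Q} {r : ℕ} {ψ : (Q → Bool) → ℂ}
    (h : schmidtRank S ψ ≤ r) : pureState ψ ∈ schmidtCone S r :=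
  AddSubmonoid.subset_closure ⟨ψ, h, rfl⟩

theorem map_mem_schmidtCone {T : Type} [Fintype T] {S : Set Q} {S' : Set T} {r r' : ℕ}
    (f : QOp Q →+ QOp T)
    (hf : ∀ ψ, schmidtRank S ψ ≤ r → f (pureState ψ) ∈ schmidtCone S' r')
    {ρ : QOp Q} (hρ : ρ ∈ schmidtCone S r) : f ρ ∈ schmidtCone S' r' := by
  have hle : schmidtCone S r ≤ (schmidtCone S' r').comap f :=
    (AddSubmonoid.closure_le).mpr <| by
      rintro _ ⟨ψ, hψ, rfl⟩
      exact hf ψ hψ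
  exact hle hρ

theorem conj_mem_schmidtCone {V : Type} {o : Q → V} {v : V} {K : QOp Q} (hK : IsLocalAt o v K)
    {P : Set V} {r : ℕ} {ρ : QOp Q} (hρ : ρ ∈ schmidtCone (o ⁻¹' P) r) :
    K * ρ * Kᴴ ∈ schmidtCone (o ⁻¹' P) r := by
  refine map_mem_schmidtCone ((AddMonoidHom.mulRight Kᴴ).comp (AddMonoidHom.mulLeft K))
    (fun ψ hψ => ?_) hρ
  change K * pureState ψ * Kᴴ ∈ _
  rw [mul_pureState_mul_conjTranspose]
  exact pureState_mem_schmidtCone ((schmidtRank_mulVec_le hK P ψ).trans hψ)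

theorem reduce_mem_schmidtCone {T : Type} [Fintype T] (τ : T ↪ Q) {S : Set Q} {r : ℕ} {ρ : QOp Q}
    (hρ : ρ ∈ schmidtCone S r) : reduce τ ρ ∈ schmidtCone (τ ⁻¹' S) r := by
  set s := complEquiv τ
  have hsum : reduce τ ρ = ∑ e, ρ.submatrix (fun a => joinEquiv s (a, e))
      (fun a => joinEquiv s (a, e)) := by
    rw [reduce_eq_partialTrace (complEquiv_inl τ)]
    ext
    simp [partialTrace, Matrix.sum_apply, s]
  rw [hsum]
  refine sum_mem fun e _ => map_mem_schmidtCone (AddMonoidHom.mk' (fun ρ : QOp Q =>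
    ρ.submatrix (fun a => joinEquiv s (a, e)) (fun a => joinEquiv s (a, e))) fun _ _ => rfl)
    (fun ψ hψ => pureState_mem_schmidtCone ?_) hρ
  exact (schmidtRank_comp_joinEquiv_le s S ψ e).trans hψ

theorem exists_smul_eq_of_posSemidef_sub {ι : Type} [Finite ι] {ψ χ : ι → ℂ}
    (h : (pureState ψ - pureState χ).PosSemidef) : ∃ c : ℂ, χ = c • ψ := by
  let _ := Fintype.ofFinite ι
  -- Test the difference on the component of `χ` orthogonal to `ψ`.
  set c := (star ψ ⬝ᵥ χ) / (star ψ ⬝ᵥ ψ)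
  set φ := χ - c • ψ
  have hψφ : star ψ ⬝ᵥ φ = 0 := by
    obtain rfl | hψ := eq_or_ne ψ 0
    · simp
    · have hne : star ψ ⬝ᵥ ψ ≠ 0 := by simpa using hψ
      simp [φ, c, hne]
  have hχφ : star χ ⬝ᵥ φ = 0 := by
    have hquad (v : ι → ℂ) :
        star φ ⬝ᵥ (pureState v *ᵥ φ) = star (star v ⬝ᵥ φ) * (star v ⬝ᵥ φ) := by
      rw [pureState_eq_vecMulVec, Matrix.vecMulVec_mulVec, op_smul_eq_smul, dotProduct_smul,
        smul_eq_mul, mul_comm, ← Matrix.star_dotProduct]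
    have hnonneg := h.dotProduct_mulVec_nonneg φ
    rw [Matrix.sub_mulVec, dotProduct_sub, hquad, hquad, hψφ, mul_zero, zero_sub,
      Complex.star_def, Complex.conj_mul', Left.nonneg_neg_iff] at hnonneg
    have hsq : ‖star χ ⬝ᵥ φ‖ ^ 2 ≤ 0 := by exact_mod_cast hnonneg
    exact norm_eq_zero.mp (pow_eq_zero_iff two_ne_zero |>.mp (hsq.antisymm (sq_nonneg _)))
  have hφ : star φ ⬝ᵥ φ = 0 := by
    nth_rw 1 [show φ = χ - c • ψ from rfl]
    rw [star_sub, star_smul, sub_dotProduct, smul_dotProduct, hχφ, hψφ, smul_zero, sub_zero]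
  exact ⟨c, sub_eq_zero.mp (dotProduct_star_self_eq_zero.mp hφ)⟩

theorem posSemidef_of_mem_schmidtCone {S : Set Q} {r : ℕ} {ρ : QOp Q}
    (hρ : ρ ∈ schmidtCone S r) : ρ.PosSemidef := by
  induction hρ using AddSubmonoid.closure_induction with
  | mem _ h =>
    obtain ⟨ψ, -, rfl⟩ := h
    exact posSemidef_pureState ψ
  | zero => exact Matrix.PosSemidef.zero
  | add _ _ _ _ h h' => exact h.add h'

theorem exists_pureState_le_of_mem_schmidtCone {S : Set Q} {r : ℕ} {ρ : QOp Q}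
    (hρ : ρ ∈ schmidtCone S r) (hne : ρ ≠ 0) :
    ∃ χ ≠ 0, schmidtRank S χ ≤ r ∧ (ρ - pureState χ).PosSemidef := by
  induction hρ using AddSubmonoid.closure_induction with
  | mem _ h =>
    obtain ⟨ψ, hψ, rfl⟩ := h
    refine ⟨ψ, ?_, hψ, ?_⟩
    · rintro rfl
      exact hne (by ext; simp [pureState])
    · rw [sub_self]
      exact Matrix.PosSemidef.zero
  | zero => exact absurd rfl hne
  | add ρ σ hρ hσ ihρ ihσ =>
    by_cases hρ0 : ρ = 0
    · subst hρ0
      simpa using ihσ (by simpa using hne)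
    · obtain ⟨χ, hχ, hr, hle⟩ := ihρ hρ0
      refine ⟨χ, hχ, hr, ?_⟩
      rw [add_sub_right_comm]
      exact hle.add (posSemidef_of_mem_schmidtCone hσ)

theorem schmidtRank_le_of_pureState_mem_schmidtCone {S : Set Q} {r : ℕ} {ψ : (Q → Bool) → ℂ}
    (hψ : ψ ≠ 0) (h : pureState ψ ∈ schmidtCone S r) : schmidtRank S ψ ≤ r := by
  have hne : pureState ψ ≠ 0 := fun h0 => hψ <| funext fun x => by
    simpa [pureState] using congrFun (congrFun h0 x) x
  obtain ⟨χ, hχ, hr, hle⟩ := exists_pureState_le_of_mem_schmidtCone h hne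
  obtain ⟨c, rfl⟩ := exists_smul_eq_of_posSemidef_sub hle
  have hc : c ≠ 0 := fun hc => hχ (by rw [hc, zero_smul])
  exact (schmidtRank_le_of_eq_smul (inv_smul_smul₀ hc ψ).symm).trans hr

end SchmidtCone

section Run

variable {V C Q : Type} [Fintype Q] {src tgt : C → V} {cc : Bool} {cs : List C} {o o' : Q → V}
  {ρ σ : QOp Q}

theorem schmidtRank_update_le (o : Q → V) (q : Q) (v : V) (P : Set V) (ψ : (Q → Bool) → ℂ) :
    schmidtRank (Function.update o q v ⁻¹' P) ψ ≤
      (if o q ∈ P ↔ v ∈ P then 1 else 2) * schmidtRank (o ⁻¹' P) ψ := by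
  split_ifs with h
  · have hcut : Function.update o q v ⁻¹' P = o ⁻¹' P := by
      ext p
      obtain rfl | hp := eq_or_ne p q
      · simp [h]
      · simp [hp]
    rw [hcut, one_mul]
  · exact schmidtRank_le_two_mul (q := q) (fun p hp => by simp [hp]) ψ

theorem Run.mem_schmidtCone (P : Set V) (h : Run src tgt cc cs o ρ o' σ) :
    ∀ {r : ℕ}, ρ ∈ schmidtCone (o ⁻¹' P) r →
      σ ∈ schmidtCone (o' ⁻¹' P) (2 ^ cs.countP (fun c => ¬(src c ∈ P ↔ tgt c ∈ P)) * r) := by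
  induction h with
  | done o ρ => simp
  | localOp _ _ _ K hlocal _ _ _ _ ih =>
    exact fun hr => sum_mem fun k _ =>
      ih k (sum_mem fun l _ => conj_mem_schmidtCone (hlocal k l) hr)
  | @send _ o _ _ _ c q hq _ ih =>
    intro r hr
    have hmove := map_mem_schmidtCone (S' := Function.update o q (tgt c) ⁻¹' P)
      (r' := (if o q ∈ P ↔ tgt c ∈ P then 1 else 2) * r) (AddMonoidHom.id _)
      (fun ψ hψ => pureState_mem_schmidtCone <|
        (schmidtRank_update_le o q (tgt c) P ψ).trans (Nat.mul_le_mul_left _ hψ)) hr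
    have hrun := ih hmove
    rw [← mul_assoc] at hrun
    convert hrun using 2
    by_cases hc : src c ∈ P ↔ tgt c ∈ P <;> simp [hc, hq, pow_succ]

theorem Run.trace_eq (h : Run src tgt cc cs o ρ o' σ) : σ.trace = ρ.trace := by
  induction h with
  | done => rfl
  | @localOp _ _ _ ρ _ _ _ K _ htrace _ σ _ ih =>
    calc (∑ k, σ k).trace = ∑ k, ∑ l, (K k l * ρ * (K k l)ᴴ).trace := by
          simp only [Matrix.trace_sum, ih]
      _ = ((∑ k, ∑ l, (K k l)ᴴ * K k l) * ρ).trace := by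
          simp only [Finset.sum_mul, Matrix.trace_sum, Matrix.trace_mul_cycle (K _ _)]
      _ = ρ.trace := by rw [htrace, Matrix.one_mul]
  | send _ _ _ _ ih => exact ih

end Run

section Distributes

variable {V C T : Type} [Fintype T] {src tgt : C → V} {cc : Bool} {cs : List C} {loc : T → V}
  {ψ : (T → Bool) → ℂ}

theorem trace_pureState_zeroVec (Q : Type) [Fintype Q] : (pureState (zeroVec Q)).trace = 1 := by
  rw [trace_pureState, Finset.sum_eq_single (fun _ => false)] <;> simp +contextual [zeroVec]

theorem Distributes.trace_eq_one {ρ : QOp T} (h : Distributes src tgt cc cs loc ρ) :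
    ρ.trace = 1 := by
  obtain ⟨n, o, o', σ, τ, hrun, -, rfl⟩ := h
  rw [trace_reduce, hrun.trace_eq]
  exact trace_pureState_zeroVec (Fin n)

theorem Distributes.schmidtRank_le (h : Distributes src tgt cc cs loc (pureState ψ))
    (hψ : ψ ≠ 0) (P : Set V) :
    schmidtRank (loc ⁻¹' P) ψ ≤ 2 ^ cs.countP (fun c => ¬(src c ∈ P ↔ tgt c ∈ P)) := by
  obtain ⟨n, o, o', σ, τ, hrun, hloc, hred⟩ := h
  have hmem := reduce_mem_schmidtCone τ <|
    hrun.mem_schmidtCone P (pureState_mem_schmidtCone (schmidtRank_zeroVec_le _))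
  have hcut : τ ⁻¹' (o' ⁻¹' P) = loc ⁻¹' P := by
    ext t
    simp [hloc]
  rw [hred, hcut, mul_one] at hmem
  exact schmidtRank_le_of_pureState_mem_schmidtCone hψ hmem

theorem Distributes.entanglementEntropy_le (h : Distributes src tgt cc cs loc (pureState ψ))
    {A : Finset T} {P : Set V} (hA : ∀ t, t ∈ A ↔ loc t ∈ P) :
    entanglementEntropy A ψ ≤ cs.countP (fun c => ¬(src c ∈ P ↔ tgt c ∈ P)) := by
  have hnorm : ∑ x, ‖ψ x‖ ^ 2 = 1 := by
    exact_mod_cast (trace_pureState ψ).symm.trans h.trace_eq_one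
  have hψ : ψ ≠ 0 := by
    rintro rfl
    simp at hnorm
  have hcut : (A : Set T) = loc ⁻¹' P := Set.ext hA
  have hbound := entanglementEntropy_le_logb_of_schmidtRank_le hnorm
    (hcut ▸ h.schmidtRank_le hψ P)
  rwa [Nat.cast_pow, Nat.cast_ofNat, Real.logb_pow, Real.logb_self_eq_one one_lt_two,
    mul_one] at hbound

end Distributes

/-! ## Protocols -/

section LocalChannel

theorem IsLocalAt.reindex {V Q Q' : Type} {o : Q → V} {v : V} {K : QOp Q}
    (hK : IsLocalAt o v K) (e : Q' ≃ Q) :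
    IsLocalAt (o ∘ e) v (K.submatrix (e.arrowCongr (Equiv.refl Bool))
      (e.arrowCongr (Equiv.refl Bool))) := by
  obtain ⟨K', hK'⟩ := hK
  refine ⟨K'.submatrix (fun x q => x ⟨e.symm q, by simpa using q.2⟩)
    (fun x q => x ⟨e.symm q, by simpa using q.2⟩), fun x y => ?_⟩
  have hagree : (∀ q, o q ≠ v → x (e.symm q) = y (e.symm q)) ↔
      ∀ q, o (e q) ≠ v → x q = y q := by
    rw [← e.forall_congr_right]
    simp
  rw [Matrix.submatrix_apply, hK']
  exact if_congr hagree rfl rfl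

variable {V Q : Type} [Fintype Q]

theorem conjTranspose_localOperator (o : Q → V) (v : V) (A : QOp {q // o q = v}) :
    (localOperator o v A)ᴴ = localOperator o v Aᴴ := by
  rw [localOperator, Matrix.conjTranspose_submatrix, Matrix.conjTranspose_kronecker,
    Matrix.conjTranspose_one, localOperator]

theorem localOperator_mul (o : Q → V) (v : V) (A B : QOp {q // o q = v}) :
    localOperator o v A * localOperator o v B = localOperator o v (A * B) := by
  rw [localOperator, localOperator, Matrix.submatrix_mul_equiv, ← Matrix.mul_kronecker_mul,
    Matrix.one_mul, localOperator]

theorem localOperator_one (o : Q → V) (v : V) : localOperator o v 1 = 1 := by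
  rw [localOperator, Matrix.one_kronecker_one, Matrix.submatrix_one_equiv]

theorem localOperator_sum {ι : Type} (o : Q → V) (v : V) (s : Finset ι)
    (A : ι → QOp {q // o q = v}) :
    localOperator o v (∑ i ∈ s, A i) = ∑ i ∈ s, localOperator o v (A i) := by
  ext x y
  simp [localOperator, Matrix.sum_apply, Matrix.kroneckerMap_apply, Finset.sum_mul]

end LocalChannel

section Protocol

variable {V C Q Q' : Type} [Fintype Q] [Fintype Q'] {src tgt : C → V} {cc : Bool} {cs : List C}
  {o o' : Q → V} {σ : QOp Q}

theorem Run.of_localChannel {ι : Type} [Fintype ι] {ρ : QOp Q} (v : V)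
    (A : ι → QOp {q // o q = v}) (hA : ∑ i, (A i)ᴴ * A i = 1)
    (h : Run src tgt cc cs o (∑ i, localOperator o v (A i) * ρ * (localOperator o v (A i))ᴴ) o' σ) :
    Run src tgt cc cs o ρ o' σ := by
  set e := (Fintype.equivFin ι).symm
  have hrun := Run.localOp (src := src) (tgt := tgt) (cc := cc) (cs := cs) (o' := o') (ρ := ρ) v 1
    (Fintype.card ι) (fun _ l => localOperator o v (A (e l)))
    (fun _ l => isLocalAt_iff.mpr ⟨_, rfl⟩) ?_ (.inr rfl) (fun _ => σ) fun _ => ?_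
  · rwa [Fin.sum_univ_one] at hrun
  · simp only [conjTranspose_localOperator, localOperator_mul, ← localOperator_sum]
    rw [Fin.sum_univ_one, e.sum_comp fun i => (A i)ᴴ * A i, hA, localOperator_one]
  · rwa [e.sum_comp fun i => localOperator o v (A i) * ρ * (localOperator o v (A i))ᴴ]

theorem Run.of_localPerm (v : V) (F : Equiv.Perm ({q // o q = v} → Bool))
    {ψ φ : (Q → Bool) → ℂ}
    (hφ : ∀ x, φ x = ψ fun q => if h : o q = v then F (fun q => x q) ⟨q, h⟩ else x q)
    (h : Run src tgt cc cs o (pureState φ) o' σ) : Run src tgt cc cs o (pureState ψ) o' σ := by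
  refine Run.of_localChannel (ι := Unit) v (fun _ => F.permMatrix ℂ) ?_ ?_
  · rw [Fintype.sum_unique, Matrix.conjTranspose_permMatrix, ← Matrix.permMatrix_mul,
      mul_inv_cancel, Matrix.permMatrix_one]
  · rw [Fintype.sum_unique, mul_pureState_mul_conjTranspose]
    convert h using 2
    funext x
    obtain ⟨⟨a, e⟩, rfl⟩ := (joinEquiv (Equiv.sumCompl (o · = v))).surjective x
    have hperm := congrFun (Matrix.permMatrix_mulVec (σ := F)
      (v := fun a' => ψ (joinEquiv (Equiv.sumCompl (o · = v)) (a', e)))) a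
    refine (localOperator_mulVec_apply ..).trans (hperm.trans ?_)
    rw [hφ, Function.comp_apply]
    congr 1
    funext q
    have hlocal : (fun q : {q // o q = v} => joinEquiv (Equiv.sumCompl (o · = v)) (a, e) q) = a :=
      funext fun q => joinEquiv_inl (Equiv.sumCompl (o · = v)) (a, e) q
    rw [hlocal, joinEquiv_sumCompl_apply, joinEquiv_sumCompl_apply]
    split_ifs <;> rfl

theorem Run.of_prepare [hQ : DecidableEq Q] (v : V) {φ : (Q → Bool) → ℂ}
    (hφ : ∀ x, φ x ≠ 0 → ∀ q, o q ≠ v → x q = false) (hnorm : ∑ x, ‖φ x‖ ^ 2 = 1)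
    (h : Run src tgt cc cs o (pureState φ) o' σ) :
    Run src tgt cc cs o (pureState (zeroVec Q)) o' σ := by
  obtain rfl : hQ = fun a b => Classical.propDecidable (a = b) := Subsingleton.elim _ _
  set s := Equiv.sumCompl (o · = v)
  set α : ({q // o q = v} → Bool) → ℂ := fun a => φ (joinEquiv s (a, fun _ => false))
  have hα (a e) : φ (joinEquiv s (a, e)) = if e = fun _ => false then α a else 0 := by
    split_ifs with he
    · rw [he]
    · by_contra hne
      refine he (funext fun q => ?_)
      simpa [s] using (joinEquiv_inr s (a, e) q).symm.trans (hφ _ hne q q.2)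
  have hα1 : star α ⬝ᵥ α = 1 := by
    rw [← (joinEquiv s).sum_comp, Fintype.sum_prod_type] at hnorm
    simp only [hα] at hnorm
    have hsum : ∑ a, ‖α a‖ ^ 2 = 1 := by simpa [apply_ite] using hnorm
    simp only [dotProduct, Pi.star_apply, Complex.star_def, Complex.conj_mul']
    exact_mod_cast hsum
  -- The channel with Kraus operators `|α⟩⟨z|` discards the qubits of `v` and prepares `α` on them.
  refine Run.of_localChannel v (fun z => Matrix.vecMulVec α (Pi.single z 1)) ?_ ?_
  · simp only [Matrix.conjTranspose_vecMulVec, Matrix.vecMulVec_mul_vecMulVec, hα1]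
    ext a a'
    simp [Matrix.sum_apply, Matrix.one_apply, Matrix.vecMulVec_apply, Pi.single_apply]
  · have hzero (z) : localOperator o v (Matrix.vecMulVec α (Pi.single z 1)) *ᵥ zeroVec Q =
        if z = fun _ => false then φ else 0 := by
      funext x
      obtain ⟨⟨a, e⟩, rfl⟩ := (joinEquiv s).surjective x
      rw [localOperator_mulVec_apply, ite_apply, hα]
      simp only [zeroVec_joinEquiv, Matrix.vecMulVec_apply, Pi.single_apply, eq_comm (b := z)]
      split_ifs <;> simp [*]
    simp only [mul_pureState_mul_conjTranspose, hzero]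
    rw [Finset.sum_eq_single (fun _ => false)]
    · simpa using h
    · intro z _ hz
      rw [if_neg hz]
      ext
      simp [pureState]
    · simp

theorem Run.reindex {ρ : QOp Q} (h : Run src tgt cc cs o ρ o' σ) (e : Q' ≃ Q) :
    Run src tgt cc cs (o ∘ e) (ρ.submatrix (e.arrowCongr (Equiv.refl Bool))
      (e.arrowCongr (Equiv.refl Bool))) (o' ∘ e)
      (σ.submatrix (e.arrowCongr (Equiv.refl Bool)) (e.arrowCongr (Equiv.refl Bool))) := by
  set E : (Q' → Bool) ≃ (Q → Bool) := e.arrowCongr (Equiv.refl Bool)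
  have hsum {a : ℕ} (K : Fin a → QOp Q) :
      (∑ k, K k).submatrix E E = ∑ k, (K k).submatrix E E := by
    ext
    simp [Matrix.sum_apply]
  induction h with
  | done o ρ => exact .done _ _
  | localOp v a b K hlocal htrace hcc σ hrest ih =>
    rw [hsum]
    refine .localOp v a b (fun k l => (K k l).submatrix E E) (fun k l => (hlocal k l).reindex e)
      ?_ hcc _ fun k => ?_
    · rw [← Matrix.submatrix_one_equiv E, ← htrace]
      simp only [hsum, Matrix.conjTranspose_submatrix, Matrix.submatrix_mul_equiv]
    · convert ih k using 1
      simp only [hsum, Matrix.conjTranspose_submatrix, Matrix.submatrix_mul_equiv]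
  | send c q hq _ ih =>
    rw [Function.update_comp_equiv] at ih
    exact .send c (e.symm q) (by simpa using hq) ih

theorem reduce_submatrix_equiv {Q Q' : Type} [Fintype Q'] (e : Q' ≃ Q) (ρ : QOp Q) :
    reduce e.symm.toEmbedding (ρ.submatrix (e.arrowCongr (Equiv.refl Bool))
      (e.arrowCongr (Equiv.refl Bool))) = ρ := by
  have hjoin (a : Q → Bool) (z : Empty → Bool) :
      e.arrowCongr (Equiv.refl Bool) (joinEquiv ((Equiv.sumEmpty Q Empty).trans e.symm) (a, z)) =
        a := by
    funext q
    exact joinEquiv_inl ((Equiv.sumEmpty Q Empty).trans e.symm) (a, z) q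
  rw [reduce_eq_partialTrace (s := (Equiv.sumEmpty Q Empty).trans e.symm) fun q => rfl]
  ext a a'
  simp [partialTrace, hjoin]

theorem Run.distributes (h : Run src tgt cc cs o (pureState (zeroVec Q)) o' σ) :
    Distributes src tgt cc cs o' σ := by
  set e := (Fintype.equivFin Q).symm
  refine ⟨Fintype.card Q, o ∘ e, o' ∘ e, _, e.symm.toEmbedding, ?_, fun t => by simp,
    reduce_submatrix_equiv e σ⟩
  convert h.reindex e using 1
  have hzero (x : Fin (Fintype.card Q) → Bool) :
      (x = fun _ => false) ↔ e.arrowCongr (Equiv.refl Bool) x = fun _ => false :=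
    (Equiv.apply_eq_iff_eq (e.arrowCongr (Equiv.refl Bool)) (y := fun _ => false)).symm
  ext x y
  simp only [pureState, zeroVec, Matrix.of_apply, Matrix.submatrix_apply, hzero]
  congr

end Protocol

/-! ## GHZ states and Bell pairs -/

section MaximallyEntangled

variable {Q T E : Type} [Fintype Q] [Fintype T] [Fintype E]

theorem norm_one_div_sqrt_two_sq : ‖(1 / (Real.sqrt 2 : ℂ))‖ ^ 2 = 1 / 2 := by
  rw [norm_div, norm_one, Complex.norm_real, Real.norm_of_nonneg (Real.sqrt_nonneg _), div_pow,
    Real.sq_sqrt zero_le_two, one_pow]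

theorem vonNeumannEntropy_inv_two_pow_smul_one (T : Type) [Fintype T] [DecidableEq T] :
    vonNeumannEntropy (((2 ^ Fintype.card T : ℝ)⁻¹ : ℂ) • (1 : QOp T)) = Fintype.card T := by
  have hdiag : (((2 ^ Fintype.card T : ℝ)⁻¹ : ℂ) • (1 : QOp T)) =
      Matrix.diagonal fun _ => (((2 ^ Fintype.card T : ℝ)⁻¹ : ℝ) : ℂ) := by
    rw [Matrix.smul_one_eq_diagonal, Complex.ofReal_inv]
  have hlog : Real.log 2 ≠ 0 := (Real.log_pos one_lt_two).ne'
  rw [hdiag, vonNeumannEntropy_diagonal, shannonEntropy]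
  simp [Real.negMulLog, hlog]

variable {s : T ⊕ E ≃ Q} {ψ : (Q → Bool) → ℂ}
  {c : ℂ} {f : (T → Bool) → E → Bool}

theorem sum_norm_sq_of_graph [DecidableEq Q] (hc : ‖c‖ ^ 2 = (2 ^ Fintype.card T)⁻¹)
    (hψ : ∀ a e, ψ (joinEquiv s (a, e)) = if e = f a then c else 0) :
    ∑ x, ‖ψ x‖ ^ 2 = 1 := by
  rw [← (joinEquiv s).sum_comp, Fintype.sum_prod_type]
  simp [hψ, apply_ite, hc]

theorem entanglementEntropy_of_graph {A : Finset Q} (hT : ∀ t, s (Sum.inl t) ∈ A)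
    (hE : ∀ e, s (Sum.inr e) ∉ A) (hf : Function.Injective f)
    (hc : ‖c‖ ^ 2 = (2 ^ Fintype.card T)⁻¹)
    (hψ : ∀ a e, ψ (joinEquiv s (a, e)) = if e = f a then c else 0) :
    entanglementEntropy A ψ = Fintype.card T := by
  have hmixed : amplitudeMatrix s ψ * (amplitudeMatrix s ψ)ᴴ =
      ((2 ^ Fintype.card T : ℝ)⁻¹ : ℂ) • 1 := by
    rw [← Complex.ofReal_inv, ← hc, Complex.ofReal_pow, ← Complex.mul_conj']
    ext a a'
    obtain rfl | ha := eq_or_ne a a'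
    · simp [amplitudeMatrix, Matrix.mul_apply, hψ]
    · simp [amplitudeMatrix, Matrix.mul_apply, hψ, Matrix.one_apply_ne ha, hf.eq_iff, ha]
  rw [entanglementEntropy_eq_amplitudeMatrix hT hE, hmixed, vonNeumannEntropy_inv_two_pow_smul_one]

end MaximallyEntangled

section GHZ

variable {m : ℕ}

theorem ghz_apply (x : PartyQubit m → Bool) :
    ghz m x = if ∀ i, x (some i) = x none then (1 / (Real.sqrt 2 : ℂ)) else 0 := by
  have hconst : ((∀ t, x t = false) ∨ ∀ t, x t = true) ↔ ∀ i, x (some i) = x none := by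
    cases h : x none <;> simp [Option.forall, h]
  simp only [ghz, hconst]

/-- The splitting of the register of the GHZ state into Alice's qubit and those of the Bobs. -/
def aliceSplit (m : ℕ) : Unit ⊕ Fin m ≃ PartyQubit m :=
  (Equiv.sumComm _ _).trans (Equiv.optionEquivSumPUnit _).symm

theorem ghz_joinEquiv_aliceSplit (a : Unit → Bool) (e : Fin m → Bool) :
    ghz m (joinEquiv (aliceSplit m) (a, e)) =
      if e = fun _ => a () then (1 / (Real.sqrt 2 : ℂ)) else 0 := by
  have halice : joinEquiv (aliceSplit m) (a, e) none = a () :=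
    joinEquiv_inl (aliceSplit m) (a, e) ()
  have hbob (i : Fin m) : joinEquiv (aliceSplit m) (a, e) (some i) = e i :=
    joinEquiv_inr (aliceSplit m) (a, e) i
  simp only [ghz_apply, halice, hbob, funext_iff]

theorem sum_norm_sq_ghz (m : ℕ) : ∑ x, ‖ghz m x‖ ^ 2 = 1 :=
  sum_norm_sq_of_graph (by simp) ghz_joinEquiv_aliceSplit

theorem entanglementEntropy_ghz [Nonempty (Fin m)] : entanglementEntropy {none} (ghz m) = 1 := by
  have hinj : Function.Injective fun (a : Unit → Bool) (_ : Fin m) => a () := fun a a' h =>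
    funext fun _ => congrFun h (Classical.arbitrary (Fin m))
  simpa using entanglementEntropy_of_graph (A := {none}) (s := aliceSplit m)
    (fun _ => Finset.mem_singleton_self none)
    (fun e => by simp [aliceSplit]) hinj (by simp) ghz_joinEquiv_aliceSplit

end GHZ

section BellPairs

variable {m : ℕ}

theorem bellPairs_apply (x : PairQubit m → Bool) :
    bellPairs m x = if ∀ i, x (i, true) = x (i, false) then (1 / (Real.sqrt 2 : ℂ)) ^ m else 0 := by
  rw [bellPairs, Finset.prod_ite_zero]
  simp [eq_comm]

/-- The splitting of the register of `m` pairs into Alice's qubits and those of the Bobs. -/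
def pairSplit (m : ℕ) : Fin m ⊕ Fin m ≃ PairQubit m :=
  (Equiv.boolProdEquivSum (Fin m)).symm.trans (Equiv.prodComm _ _)

theorem bellPairs_joinEquiv_pairSplit (a e : Fin m → Bool) :
    bellPairs m (joinEquiv (pairSplit m) (a, e)) =
      if e = a then (1 / (Real.sqrt 2 : ℂ)) ^ m else 0 := by
  have halice (i : Fin m) : joinEquiv (pairSplit m) (a, e) (i, false) = a i :=
    joinEquiv_inl (pairSplit m) (a, e) i
  have hbob (i : Fin m) : joinEquiv (pairSplit m) (a, e) (i, true) = e i :=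
    joinEquiv_inr (pairSplit m) (a, e) i
  simp only [bellPairs_apply, halice, hbob, funext_iff]

theorem norm_one_div_sqrt_two_pow_sq (m : ℕ) :
    ‖(1 / (Real.sqrt 2 : ℂ)) ^ m‖ ^ 2 = (2 ^ Fintype.card (Fin m))⁻¹ := by
  rw [norm_pow, pow_right_comm, norm_one_div_sqrt_two_sq, one_div, inv_pow, Fintype.card_fin]

theorem sum_norm_sq_bellPairs (m : ℕ) : ∑ x, ‖bellPairs m x‖ ^ 2 = 1 :=
  sum_norm_sq_of_graph (f := id) (norm_one_div_sqrt_two_pow_sq m) bellPairs_joinEquiv_pairSplit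

theorem mem_alicePairQubits {t : PairQubit m} : t ∈ alicePairQubits m ↔ t.2 = false := by
  simp [alicePairQubits]

theorem entanglementEntropy_bellPairs (m : ℕ) :
    entanglementEntropy (alicePairQubits m) (bellPairs m) = m := by
  simpa using entanglementEntropy_of_graph (s := pairSplit m) (f := id)
    (fun t => mem_alicePairQubits.mpr rfl) (fun e => by simp [mem_alicePairQubits, pairSplit])
    Function.injective_id (norm_one_div_sqrt_two_pow_sq m) bellPairs_joinEquiv_pairSplit

theorem reduce_pureState_of_eq_mul {Q T E : Type} [Fintype Q] [Fintype T] [Finite E]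
    [DecidableEq Q] [DecidableEq T] {τ : T ↪ Q} {s : T ⊕ E ≃ Q}
    (h : ∀ t, s (Sum.inl t) = τ t) {ψ : (Q → Bool) → ℂ} {φ : (T → Bool) → ℂ}
    {β : (E → Bool) → ℂ} (hψ : ∀ a e, ψ (joinEquiv s (a, e)) = φ a * β e)
    (hψ1 : ∑ x, ‖ψ x‖ ^ 2 = 1) (hφ1 : ∑ a, ‖φ a‖ ^ 2 = 1) :
    reduce τ (pureState ψ) = pureState φ := by
  let _ := Fintype.ofFinite E
  have hβ : β ⬝ᵥ star β = 1 := by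
    rw [← (joinEquiv s).sum_comp, Fintype.sum_prod_type] at hψ1
    simp only [hψ, norm_mul, mul_pow, ← Finset.mul_sum, ← Finset.sum_mul, hφ1, one_mul] at hψ1
    simp only [dotProduct, Pi.star_apply, Complex.star_def, Complex.mul_conj']
    exact_mod_cast hψ1
  have hM : amplitudeMatrix s ψ = Matrix.vecMulVec φ β := Matrix.ext hψ
  rw [reduce_pureState h, hM, Matrix.conjTranspose_vecMulVec, Matrix.vecMulVec_mul_vecMulVec, hβ,
    one_smul, pureState_eq_vecMulVec]

theorem reduce_pairEmb (i : Fin m) :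
    reduce (pairEmb m i) (pureState (bellPairs m)) = pureState (ghz 1) := by
  obtain ⟨s, hs⟩ : ∃ s : PartyQubit 1 ⊕ ↑(Set.range (pairEmb m i))ᶜ ≃ PairQubit m,
      ∀ t, s (Sum.inl t) = pairEmb m i t := ⟨complEquiv _, complEquiv_inl _⟩
  have hpair (a e) (b : PartyQubit 1) : joinEquiv s (a, e) (pairEmb m i b) = a b := by
    rw [← hs, joinEquiv_inl]
  have hrest (a e) {j : Fin m} (hj : j ≠ i) (b : Bool) :
      joinEquiv s (a, e) (j, b) = joinEquiv s (fun _ => false, e) (j, b) := by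
    obtain ⟨t | r, hq⟩ := s.surjective (j, b)
    · exact absurd (congrArg Prod.fst ((hs t).symm.trans hq)).symm hj
    · rw [← hq, joinEquiv_inr, joinEquiv_inr]
  have hcond (a e) : (∀ j, joinEquiv s (a, e) (j, true) = joinEquiv s (a, e) (j, false)) ↔
      a (some 0) = a none ∧ ∀ j ≠ i, joinEquiv s (fun _ => false, e) (j, true) =
        joinEquiv s (fun _ => false, e) (j, false) := by
    rw [← hpair a e none, ← hpair a e (some 0)]
    refine ⟨fun h => ⟨h i, fun j hj => ?_⟩, fun h j => ?_⟩
    · rw [← hrest a e hj, ← hrest a e hj, h]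
    · obtain rfl | hj := eq_or_ne j i
      · exact h.1
      · rw [hrest a e hj, hrest a e hj, h.2 j hj]
  have hsqrt : (Real.sqrt 2 : ℂ) ≠ 0 := by simp
  refine reduce_pureState_of_eq_mul hs
    (β := fun e => Real.sqrt 2 * bellPairs m (joinEquiv s (fun _ => false, e))) (fun a e => ?_)
    (sum_norm_sq_bellPairs m) (sum_norm_sq_ghz 1)
  simp only [bellPairs_apply, ghz_apply, hcond, Fin.forall_fin_one, true_and, ite_and]
  split_ifs <;> simp [hsqrt]

end BellPairs

section Protocols

variable {m : ℕ} {cc : Bool}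

section Transmission

variable {V C Q : Type} [Fintype Q] {src tgt : C → V} {cs : List C} {o o₁ o' : Q → V} {ρ σ : QOp Q}

theorem Run.of_send (c : C) (q : Q) (hq : o q = src c) (hq₁ : o₁ q = tgt c)
    (ho₁ : ∀ r ≠ q, o₁ r = o r) (h : Run src tgt cc cs o₁ ρ o' σ) :
    Run src tgt cc (c :: cs) o ρ o' σ :=
  .send c q hq (Function.eq_update_iff.mpr ⟨hq₁, ho₁⟩ ▸ h)

theorem Run.of_relay (c d : C) (q : Q) (hq : o q = src c) (hcd : tgt c = src d)
    (h : Run src tgt cc cs (Function.update o q (tgt d)) ρ o' σ) :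
    Run src tgt cc (c :: d :: cs) o ρ o' σ :=
  .send c q hq (.send d q ((Function.update_self ..).trans hcd) (by rwa [Function.update_idem]))

theorem Run.of_moves {p : Q → List C} {l : List Q} (hl : l.Nodup) {o₀ : Q → V}
    (hp : ∀ q ∈ l, ∀ cs o o' σ, o q = o₀ q →
      Run src tgt cc cs (Function.update o q (o₁ q)) ρ o' σ → Run src tgt cc (p q ++ cs) o ρ o' σ)
    (h : ∀ q ∉ l, o₁ q = o₀ q) : Run src tgt cc (l.flatMap p) o₀ ρ o₁ ρ := by
  induction l generalizing o₀ with
  | nil =>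
    obtain rfl : o₁ = o₀ := funext fun q => h q List.not_mem_nil
    exact .done _ _
  | cons q l ih =>
    obtain ⟨hq, hl⟩ := List.nodup_cons.mp hl
    refine hp q List.mem_cons_self _ _ _ _ rfl (ih hl (fun r hr cs o o' σ ho => ?_) fun r hr => ?_)
    · rw [Function.update_of_ne fun hrq : r = q => hq (hrq ▸ hr)] at ho
      exact hp r (List.mem_cons_of_mem _ hr) cs o o' σ ho
    · obtain rfl | hrq := eq_or_ne r q
      · rw [Function.update_self]
      · rw [Function.update_of_ne hrq, h r (List.not_mem_cons_of_ne_of_not_mem hrq hr)]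

theorem Run.sum_norm_sq_eq [hQ : DecidableEq Q] {ψ φ : (Q → Bool) → ℂ}
    (h : Run src tgt cc cs o (pureState ψ) o' (pureState φ)) :
    ∑ x, ‖φ x‖ ^ 2 = ∑ x, ‖ψ x‖ ^ 2 := by
  obtain rfl : hQ = fun a b => Classical.propDecidable (a = b) := Subsingleton.elim _ _
  have htrace := h.trace_eq
  rw [trace_pureState, trace_pureState] at htrace
  exact_mod_cast htrace

end Transmission

/-- The controlled negation of all bits other than `t₀`, with the bit `t₀` as control. -/
noncomputable def fanOut {T : Type} (t₀ : T) : Equiv.Perm (T → Bool) :=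
  Function.Involutive.toPerm (fun x t => if t = t₀ then x t else xor (x t) (x t₀)) fun x => by
    funext t
    by_cases ht : t = t₀ <;> simp [ht]

theorem fanOut_apply {T : Type} (t₀ : T) (x : T → Bool) (t : T) :
    fanOut t₀ x t = if t = t₀ then x t else xor (x t) (x t₀) := rfl

/-- The state in which Alice's qubit and that of Bob `i₀` form a Bell pair and all other qubits are
`|0⟩`. A controlled negation of the other Bobs' qubits turns it into the GHZ state. -/
noncomputable def seedPair (i₀ : Fin m) : (PartyQubit m → Bool) → ℂ := fun x =>
  if x (some i₀) = x none ∧ ∀ j ≠ i₀, x (some j) = false then (1 / (Real.sqrt 2 : ℂ)) else 0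

/-- The locations of the qubits when the router has received its half of the Bell pair, and applies
the controlled negation. -/
def fanOutLoc : PartyQubit m → Node m
  | none => Node.alice
  | some _ => Node.router

theorem fanOutLoc_some (i : Fin m) : fanOutLoc (some i) = Node.router := rfl

theorem fanOutLoc_none : fanOutLoc (none : PartyQubit m) = Node.alice := rfl

theorem Run.of_fanOut (i₀ : Fin m) {cs : List (Channel m)} {o' : PartyQubit m → Node m}
    {σ : QOp (PartyQubit m)}
    (h : Run (chanSrc m) (chanTgt m) cc cs fanOutLoc (pureState (ghz m)) o' σ) :
    Run (chanSrc m) (chanTgt m) cc cs fanOutLoc (pureState (seedPair i₀)) o' σ := by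
  refine h.of_localPerm Node.router (fanOut ⟨some i₀, fanOutLoc_some i₀⟩) fun x => ?_
  have hcond : (∀ i, x (some i) = x none) ↔
      x (some i₀) = x none ∧ ∀ j ≠ i₀, xor (x (some j)) (x (some i₀)) = false := by
    refine ⟨fun h => ⟨h i₀, fun j _ => by simp [h]⟩, fun ⟨h₀, h⟩ i => ?_⟩
    obtain rfl | hi := eq_or_ne i i₀
    · exact h₀
    · rw [← h₀]
      simpa using h i hi
  simp only [ghz_apply, hcond, seedPair]
  simp +contextual [fanOutLoc_none, fanOutLoc_some, fanOut_apply]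

theorem distributes_ghz [Nonempty (Fin m)] (cc : Bool) :
    Distributes (chanSrc m) (chanTgt m) cc (none :: (List.finRange m).map some) (partyLoc m)
      (pureState (ghz m)) := by
  obtain ⟨i₀⟩ := ‹Nonempty (Fin m)›
  have hdist : Run (chanSrc m) (chanTgt m) cc ((List.finRange m).map some) fanOutLoc
      (pureState (ghz m)) (partyLoc m) (pureState (ghz m)) := by
    rw [← List.flatMap_singleton' ((List.finRange m).map some)]
    refine .of_moves ((List.nodup_finRange m).map (Option.some_injective _)) ?_ ?_
    · intro q hq cs o o' σ ho h
      obtain ⟨i, -, rfl⟩ := List.mem_map.mp hq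
      exact .send (some i) (some i) ho h
    · rintro (_ | i) hq
      · rfl
      · exact absurd (List.mem_map_of_mem (List.mem_finRange i)) hq
  have hfan := hdist.of_fanOut i₀
  have hnorm : ∑ x, ‖seedPair i₀ x‖ ^ 2 = 1 := hfan.sum_norm_sq_eq.symm.trans (sum_norm_sq_ghz m)
  refine Run.distributes (o := Function.update fanOutLoc (some i₀) Node.alice) ?_
  refine Run.of_prepare Node.alice ?_ hnorm
    (.of_send none (some i₀) (Function.update_self ..) rfl (fun r hr => ?_) hfan)
  · rintro x hx (_ | j) hj
    · simp [fanOutLoc] at hj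
    · refine (ite_ne_right_iff.mp hx).1.2 j fun h => hj ?_
      rw [h, Function.update_self]
  · rw [Function.update_of_ne hr]

theorem distributes_bellPairs (cc : Bool) (m : ℕ) :
    Distributes (chanSrc m) (chanTgt m) cc ((List.finRange m).flatMap fun i => [none, some i])
      (pairLoc m) (pureState (bellPairs m)) := by
  have hmove : Run (chanSrc m) (chanTgt m) cc ((List.finRange m).flatMap fun i => [none, some i])
      (fun _ => Node.alice) (pureState (bellPairs m)) (pairLoc m) (pureState (bellPairs m)) := by
    have hflat : (List.finRange m).flatMap (fun i => [none, some i]) =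
        ((List.finRange m).map fun i => (i, true)).flatMap
          fun q : PairQubit m => [none, some q.1] := by
      rw [List.flatMap_map]
    rw [hflat]
    refine .of_moves ((List.nodup_finRange m).map fun i j h => congrArg Prod.fst h) ?_ ?_
    · intro q hq cs o o' σ ho h
      obtain ⟨i, -, rfl⟩ := List.mem_map.mp hq
      exact .of_relay none (some i) _ ho rfl h
    · rintro ⟨i, _ | _⟩ hq
      · rfl
      · exact absurd (List.mem_map_of_mem (List.mem_finRange i)) hq
  exact (Run.of_prepare Node.alice (fun _ _ _ h => absurd rfl h) (sum_norm_sq_bellPairs m)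
    hmove).distributes

theorem mem_alicePairQubits_iff_pairLoc {t : PairQubit m} :
    t ∈ alicePairQubits m ↔ pairLoc m t ∈ ({Node.alice} : Set (Node m)) := by
  obtain ⟨i, _ | _⟩ := t <;> simp [mem_alicePairQubits, pairLoc]

theorem le_count_none_of_distributes_bellPairs {cs : List (Channel m)}
    (h : Distributes (chanSrc m) (chanTgt m) cc cs (pairLoc m) (pureState (bellPairs m))) :
    m ≤ cs.count none := by
  have hcut := h.entanglementEntropy_le fun _ => mem_alicePairQubits_iff_pairLoc
  rw [entanglementEntropy_bellPairs, Nat.cast_le] at hcut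
  refine hcut.trans (List.countP_mono_left fun c _ hc => ?_)
  cases c <;> simp [chanSrc, chanTgt] at hc ⊢

theorem isLeast_uses2QKD (cc : Bool) (m : ℕ) : IsLeast (uses2QKD cc m) m := by
  refine ⟨⟨(List.finRange m).map fun i => [none, some i], by simp, by simp, ?_⟩, ?_⟩
  · rw [← List.flatMap_def]
    exact distributes_bellPairs cc m
  · rintro n ⟨L, rfl, hL, h⟩
    calc m ≤ L.flatten.count none := le_count_none_of_distributes_bellPairs h
      _ = (L.map (List.count none)).sum := List.count_flatten
      _ ≤ (L.map (List.count none)).length • 1 := List.sum_le_card_nsmul _ 1 <| by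
        simpa using fun l hl => List.nodup_iff_count_le_one.mp (hL l hl) none
      _ = L.length := by simp

theorem isLeast_usesNQKD [Nonempty (Fin m)] (cc : Bool) : IsLeast (usesNQKD cc m) 1 := by
  refine ⟨⟨[none :: (List.finRange m).map some], rfl, ?_, ?_⟩, ?_⟩
  · simpa using (List.nodup_finRange m).map (Option.some_injective _)
  · simpa using distributes_ghz cc
  · rintro n ⟨L, rfl, -, h⟩
    by_contra! hL
    obtain rfl : L = [] := List.length_eq_zero_iff.mp (Nat.lt_one_iff.mp hL)
    have hcut := h.entanglementEntropy_le (A := {none}) (P := {Node.alice})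
      (by rintro (_ | _) <;> simp [partyLoc])
    rw [entanglementEntropy_ghz] at hcut
    norm_num at hcut

theorem entanglementEntropy_le_length_of_distributes {cs : List Unit} {T : Type} [Fintype T]
    {A : Finset T} {loc : T → Side} {ψ : (T → Bool) → ℂ} (hA : ∀ t, t ∈ A ↔ loc t = Side.A)
    (h : Distributes cutSrc cutTgt cc cs loc (pureState ψ)) :
    entanglementEntropy A ψ ≤ cs.length :=
  (h.entanglementEntropy_le (P := {Side.A}) hA).trans (mod_cast List.countP_le_length)

theorem le_length_of_distributes_bellPairs {cs : List Unit}
    (h : Distributes cutSrc cutTgt cc cs (fun t => side (pairLoc m t)) (pureState (bellPairs m))) :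
    m ≤ cs.length := by
  have hcut := entanglementEntropy_le_length_of_distributes (A := alicePairQubits m)
    (by rintro ⟨i, _ | _⟩ <;> simp [mem_alicePairQubits, pairLoc, side]) h
  rwa [entanglementEntropy_bellPairs, Nat.cast_le] at hcut

end Protocols

/-! ## Secret fraction -/

section Parameters

variable {m d : ℕ}

theorem sum_pow_numY_mul_pauliXY (c : ℂ) (a b : PartyQubit m → Bool) :
    ∑ y, c ^ numY y * pauliXY y a b =
      ∏ t, (c * pauliY (a t) (b t) + pauliX (a t) (b t)) := by
  have hpow (y : PartyQubit m → Bool) : c ^ numY y = ∏ t, if y t then c else 1 := by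
    rw [Finset.prod_ite, Finset.prod_const, Finset.prod_const_one, mul_one, numY]
  have hprod := Finset.prod_univ_sum (fun _ : PartyQubit m => (Finset.univ : Finset Bool))
    fun t y => (if y then c else 1) * if y then pauliY (a t) (b t) else pauliX (a t) (b t)
  simp only [Fintype.piFinset_univ, Fintype.sum_bool, if_true, Bool.false_eq_true, if_false,
    one_mul] at hprod
  simp only [hprod, hpow, pauliXY, Matrix.of_apply, Finset.prod_mul_distrib]

theorem prod_I_mul_pauliY_add_pauliX (a b : PartyQubit m → Bool) :
    ∏ t, (Complex.I * pauliY (a t) (b t) + pauliX (a t) (b t)) =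
      (2 ^ (m + 1) : ℂ) * Matrix.single (fun _ => false) (fun _ => true) 1 a b := by
  have hentry (k l : Bool) : Complex.I * pauliY k l + pauliX k l =
      if false = k ∧ true = l then 2 else 0 := by
    cases k <;> cases l <;> norm_num [pauliX, pauliY]
  simp only [hentry]
  simp [Finset.prod_ite_zero, Matrix.single_apply, funext_iff, forall_and]

theorem prod_neg_I_mul_pauliY_add_pauliX (a b : PartyQubit m → Bool) :
    ∏ t, (-Complex.I * pauliY (a t) (b t) + pauliX (a t) (b t)) =
      (2 ^ (m + 1) : ℂ) * Matrix.single (fun _ => true) (fun _ => false) 1 a b := by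
  have hentry (k l : Bool) : -Complex.I * pauliY k l + pauliX k l =
      if true = k ∧ false = l then 2 else 0 := by
    cases k <;> cases l <;> norm_num [pauliX, pauliY]
  simp only [hentry]
  simp [Finset.prod_ite_zero, Matrix.single_apply, funext_iff, forall_and]

theorem ite_even_neg_one_pow_half (n : ℕ) :
    (if Even n then (-1 : ℂ) ^ (n / 2) else 0) = (Complex.I ^ n + (-Complex.I) ^ n) / 2 := by
  split_ifs with hn
  · obtain ⟨k, rfl⟩ := even_iff_two_dvd.mp hn
    simp [pow_mul]
  · rw [(Nat.not_even_iff_odd.mp hn).neg_pow, add_neg_cancel, zero_div]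

theorem sum_smul_pauliXY :
    ∑ y : PartyQubit m → Bool, (if Even (numY y) then (-1 : ℂ) ^ (numY y / 2) else 0) • pauliXY y =
      (2 : ℂ) ^ m • ∑ b : Bool, Matrix.single (fun _ => !b) (fun _ => b) 1 := by
  ext a b
  simp only [Matrix.sum_apply, Matrix.smul_apply, Matrix.add_apply, smul_eq_mul,
    ite_even_neg_one_pow_half, add_mul, div_mul_eq_mul_div, ← Finset.sum_div,
    Finset.sum_add_distrib, sum_pow_numY_mul_pauliXY, prod_I_mul_pauliY_add_pauliX,
    prod_neg_I_mul_pauliY_add_pauliX, Fintype.sum_bool, Bool.not_true, Bool.not_false]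
  ring

theorem depolarisedX_eq_sum_re (σ : QOp (PartyQubit m)) :
    depolarisedX σ = ∑ b : Bool, (σ (fun _ => b) (fun _ => !b)).re := by
  have hre (y : PartyQubit m → Bool) :
      (if Even (numY y) then (-1 : ℝ) ^ (numY y / 2) * (σ * pauliXY y).trace.re else 0) =
        (σ * (if Even (numY y) then (-1 : ℂ) ^ (numY y / 2) else 0) • pauliXY y).trace.re := by
    split_ifs
    · rw [Matrix.mul_smul, Matrix.trace_smul, smul_eq_mul, ← Complex.re_ofReal_mul]
      push_cast
      rfl
    · simp
  have hpow : (2 : ℂ) ^ m = ((2 ^ m : ℝ) : ℂ) := by push_cast; rfl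
  simp only [depolarisedX, hre]
  rw [← Complex.re_sum, ← Matrix.trace_sum, ← Finset.mul_sum, sum_smul_pauliXY, Matrix.mul_smul,
    Matrix.trace_smul, smul_eq_mul, hpow, Complex.re_ofReal_mul, mul_div_cancel_left₀ _ (by simp),
    Finset.mul_sum, Matrix.trace_sum, Complex.re_sum]
  simp [Matrix.trace_mul_single]

theorem sum_eq_sum_const_add {M : Type} [AddCommMonoid M] (F : (PartyQubit m → Bool) → M) :
    ∑ x, F x = ∑ b : Bool, F (fun _ => b) + ∑ x with ¬ ∀ i, x (some i) = x none, F x := by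
  rw [← Finset.sum_filter_add_sum_filter_not _ fun x => ∀ i, x (some i) = x none]
  congr 1
  have hconst {x : PartyQubit m → Bool} (hx : ∀ i, x (some i) = x none) :
      (fun _ => x none) = x := by
    simp [funext_iff, Option.forall, hx]
  refine Finset.sum_bij' (fun x _ => x none) (fun b _ _ => b) ?_ ?_ ?_ ?_ ?_ <;>
    simp +contextual [hconst]

theorem ghz_const (b : Bool) : ghz m (fun _ => b) = 1 / (Real.sqrt 2 : ℂ) := by
  rw [ghz_apply, if_pos fun _ => rfl]

theorem sum_norm_sq_eq_depolarisedX_add (ψ : (PartyQubit m → Bool) × Fin d → ℂ) :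
    ∑ p, ‖ψ p‖ ^ 2 = depolarisedX (honestState ψ) +
      (∑ e, ‖ψ (fun _ => false, e) - ψ (fun _ => true, e)‖ ^ 2 +
        ∑ x with ¬ ∀ i, x (some i) = x none, ∑ e, ‖ψ (x, e)‖ ^ 2) := by
  have hsub (a b : ℂ) : ‖a - b‖ ^ 2 = ‖a‖ ^ 2 + ‖b‖ ^ 2 - (a * star b).re - (b * star a).re := by
    simp only [← Complex.normSq_eq_norm_sq, Complex.normSq_sub, Complex.star_def, Complex.mul_re,
      Complex.conj_re, Complex.conj_im]
    ring
  rw [Fintype.sum_prod_type, sum_eq_sum_const_add, depolarisedX_eq_sum_re]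
  simp only [Fintype.sum_bool, honestState, Matrix.of_apply, Complex.re_sum, hsub,
    Finset.sum_add_distrib, Finset.sum_sub_distrib, Bool.not_true, Bool.not_false]
  ring

theorem depolarisedX_ghz : depolarisedX (pureState (ghz m)) = 1 := by
  simp only [depolarisedX_eq_sum_re, pureState, Matrix.of_apply, ghz_const, Complex.star_def,
    Complex.mul_conj', norm_one_div_sqrt_two_sq, ← Complex.ofReal_pow]
  norm_num

theorem exists_eq_ghz_mul_of_depolarisedX_eq_one {ψ : (PartyQubit m → Bool) × Fin d → ℂ}
    (hψ : ∑ p, ‖ψ p‖ ^ 2 = 1) (hX : depolarisedX (honestState ψ) = 1) :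
    ∃ v : Fin d → ℂ, ∑ e, ‖v e‖ ^ 2 = 1 ∧ ∀ x e, ψ (x, e) = ghz m x * v e := by
  have hzero := hψ
  rw [sum_norm_sq_eq_depolarisedX_add, hX, add_eq_left,
    add_eq_zero_iff_of_nonneg (by positivity) (by positivity),
    Finset.sum_eq_zero_iff_of_nonneg fun _ _ => by positivity,
    Finset.sum_eq_zero_iff_of_nonneg fun _ _ => by positivity] at hzero
  have heq (b : Bool) (e : Fin d) : ψ (fun _ => b, e) = ψ (fun _ => false, e) := by
    cases b
    · rfl
    · exact (sub_eq_zero.mp (by simpa using hzero.1 e (Finset.mem_univ e))).symm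
  have hnonconst {x : PartyQubit m → Bool} (hx : ¬ ∀ i, x (some i) = x none) (e : Fin d) :
      ψ (x, e) = 0 := by
    have hx0 := hzero.2 x (Finset.mem_filter.mpr ⟨Finset.mem_univ x, hx⟩)
    simpa using (Finset.sum_eq_zero_iff_of_nonneg fun _ _ => by positivity).mp hx0 e
      (Finset.mem_univ e)
  have hsqrt : (Real.sqrt 2 : ℂ) ≠ 0 := by simp
  obtain ⟨v, hv⟩ : ∃ v : Fin d → ℂ, ∀ x e, ψ (x, e) = ghz m x * v e := by
    refine ⟨fun e => Real.sqrt 2 * ψ (fun _ => false, e), fun x e => ?_⟩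
    rw [ghz_apply]
    split_ifs with hx
    · obtain ⟨b, rfl⟩ : ∃ b : Bool, x = fun _ => b :=
        ⟨x none, funext fun t => by cases t <;> simp [hx]⟩
      rw [heq, ← mul_assoc, one_div_mul_cancel hsqrt, one_mul]
    · rw [hnonconst hx, zero_mul]
  refine ⟨v, ?_, hv⟩
  simpa only [Fintype.sum_prod_type, hv, norm_mul, mul_pow, ← Finset.mul_sum, ← Finset.sum_mul,
    sum_norm_sq_ghz, one_mul] using hψ

end Parameters

section BitChannel

variable {w : Bool → Bool → ℝ}

/-- The mutual information `I(U;K)` of a uniformly distributed bit `K` and the output `U` of the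
bit channel `w`, in the form `H(U) + H(K) - H(U,K)` with `H(K) = 1`. -/
noncomputable def bitChannelInformation (w : Bool → Bool → ℝ) : ℝ :=
  shannonEntropy (fun u => ∑ k, w k u / 2) + 1 -
    shannonEntropy fun p : Bool × Bool => w p.2 p.1 / 2

theorem shannonEntropy_fair_bit : shannonEntropy (fun _ : Bool => (1 / 2 : ℝ)) = 1 := by
  have hlog : Real.log 2 ≠ 0 := (Real.log_pos one_lt_two).ne'
  simp [shannonEntropy, Real.negMulLog, hlog]

theorem isBitChannel_id : IsBitChannel fun k u => if k = u then 1 else 0 :=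
  ⟨fun k u => by positivity, fun k => by simp⟩

theorem bitChannelInformation_id :
    bitChannelInformation (fun k u => if k = u then 1 else 0) = 1 := by
  have hjoint : shannonEntropy (fun p : Bool × Bool => (if p.2 = p.1 then (1 : ℝ) else 0) / 2) =
      shannonEntropy fun _ : Bool => (1 / 2 : ℝ) := by
    simp [shannonEntropy, Fintype.sum_prod_type, two_mul]
  have hout : (fun u => ∑ k : Bool, (if k = u then (1 : ℝ) else 0) / 2) = fun _ => 1 / 2 := by
    simp [← Finset.sum_div]
  rw [bitChannelInformation, hjoint, hout, shannonEntropy_fair_bit, add_sub_cancel_right]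

theorem bitChannelInformation_le_one (hw : IsBitChannel w) : bitChannelInformation w ≤ 1 := by
  have hw2 (k u : Bool) : 0 ≤ w k u / 2 := div_nonneg (hw.1 k u) zero_le_two
  have htotal : ∑ u, ∑ k, w k u / 2 = 1 := by
    rw [Finset.sum_comm]
    simp only [← Finset.sum_div, hw.2]
    simp
  have hout : shannonEntropy (fun u => ∑ k, w k u / 2) ≤ 1 := by
    simpa using shannonEntropy_le_logb (r := 2) (fun u => Finset.sum_nonneg fun k _ => hw2 k u)
      htotal (Fintype.card_subtype_le _)
  have hjoint : 1 ≤ shannonEntropy fun p : Bool × Bool => w p.2 p.1 / 2 := by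
    have h := shannonEntropy_marginal_le (d := fun p : Bool × Bool => w p.2 p.1 / 2)
      fun p => hw2 _ _
    simpa only [← Finset.sum_div, hw.2, shannonEntropy_fair_bit] using h
  rw [bitChannelInformation]
  linarith

end BitChannel

section ProductWithEve

variable {m d : ℕ} {ψ : (PartyQubit m → Bool) × Fin d → ℂ} {φ : (PartyQubit m → Bool) → ℂ}
  {v : Fin d → ℂ} {w : Bool → Bool → ℝ}

theorem honestState_of_eq_mul (hv : ∑ e, ‖v e‖ ^ 2 = 1) (hψ : ∀ x e, ψ (x, e) = φ x * v e) :
    honestState ψ = pureState φ := by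
  have hv' : ∑ e, v e * star (v e) = 1 := by
    simpa [Complex.mul_conj'] using congrArg Complex.ofReal hv
  ext x x'
  simp only [honestState, pureState, Matrix.of_apply, hψ, star_mul', mul_mul_mul_comm _ (v _),
    ← Finset.mul_sum, hv', mul_one]

theorem eveState_of_eq_mul (hφ : ∑ x, ‖φ x‖ ^ 2 = 1) (hψ : ∀ x e, ψ (x, e) = φ x * v e) :
    eveState ψ = pureState v := by
  have hφ' : ∑ x, φ x * star (φ x) = 1 := by
    simpa [Complex.mul_conj'] using congrArg Complex.ofReal hφ
  ext e e'
  simp only [eveState, pureState, Matrix.of_apply, hψ, star_mul', mul_mul_mul_comm _ (v _),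
    ← Finset.sum_mul, hφ', one_mul]

theorem bitEveState_of_eq_mul (hψ : ∀ x e, ψ (x, e) = φ x * v e) :
    bitEveState w ψ =
      (Matrix.diagonal fun u => ((∑ x, w (x none) u * ‖φ x‖ ^ 2 : ℝ) : ℂ)) ⊗ₖ pureState v := by
  ext ⟨u, e⟩ ⟨u', e'⟩
  simp only [bitEveState, Matrix.of_apply, Matrix.kroneckerMap_apply, Matrix.diagonal_apply,
    ite_mul, zero_mul]
  congr 1
  push_cast
  rw [Finset.sum_mul]
  refine Finset.sum_congr rfl fun x _ => ?_
  rw [hψ, hψ, star_mul', ← Complex.mul_conj', pureState, Matrix.of_apply, Complex.star_def]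
  ring

theorem condEntropyEve_of_eq_mul (hφ : ∑ x, ‖φ x‖ ^ 2 = 1) (hv : ∑ e, ‖v e‖ ^ 2 = 1)
    (hψ : ∀ x e, ψ (x, e) = φ x * v e) :
    condEntropyEve w ψ = shannonEntropy fun u => ∑ x, w (x none) u * ‖φ x‖ ^ 2 := by
  rw [condEntropyEve, eveState_of_eq_mul hφ hψ, bitEveState_of_eq_mul hψ,
    vonNeumannEntropy_pureState hv, vonNeumannEntropy_kronecker_pureState _ hv,
    vonNeumannEntropy_diagonal, sub_zero]
  exact Matrix.isHermitian_diagonal_iff.mpr fun _ => Complex.conj_ofReal _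

end ProductWithEve

section SecretFraction

variable {m d : ℕ} {w : Bool → Bool → ℝ}

theorem sum_mul_norm_sq_ghz (f : (PartyQubit m → Bool) → ℝ) :
    ∑ x, f x * ‖ghz m x‖ ^ 2 = ∑ k : Bool, f (fun _ => k) / 2 := by
  rw [sum_eq_sum_const_add, Finset.sum_eq_zero (s := Finset.univ.filter _), add_zero]
  · simp only [ghz_const, norm_one_div_sqrt_two_sq, mul_one_div]
  · intro x hx
    rw [ghz_apply, if_neg (Finset.mem_filter.mp hx).2]
    simp

theorem condEntropyBob_ghz (hw : IsBitChannel w) (i : Fin m) :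
    condEntropyBob w (pureState (ghz m)) i =
      shannonEntropy (fun p : Bool × Bool => w p.2 p.1 / 2) - 1 := by
  have hjoint : bitBobDist w (pureState (ghz m)) i = fun p => w p.2 p.1 / 2 := by
    funext p
    have h := sum_mul_norm_sq_ghz (m := m) fun x => if x (some i) = p.2 then w (x none) p.1 else 0
    simp only [ite_mul, zero_mul] at h
    simp only [bitBobDist, pureState, Matrix.of_apply, Complex.star_def, Complex.mul_conj',
      ← Complex.ofReal_pow, Complex.ofReal_re, h]
    simp [ite_div]
  rw [condEntropyBob, hjoint]
  simp only [← Finset.sum_div, hw.2, shannonEntropy_fair_bit]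

theorem condEntropyEve_sub_iSup_condEntropyBob [Nonempty (Fin m)] (hw : IsBitChannel w)
    {ψ : (PartyQubit m → Bool) × Fin d → ℂ} (hψ : ∑ p, ‖ψ p‖ ^ 2 = 1)
    (hX : depolarisedX (honestState ψ) = 1) :
    condEntropyEve w ψ - ⨆ i, condEntropyBob w (honestState ψ) i = bitChannelInformation w := by
  obtain ⟨v, hv, hmul⟩ := exists_eq_ghz_mul_of_depolarisedX_eq_one hψ hX
  simp only [condEntropyEve_of_eq_mul (sum_norm_sq_ghz m) hv hmul, honestState_of_eq_mul hv hmul,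
    condEntropyBob_ghz hw, ciSup_const, sum_mul_norm_sq_ghz, bitChannelInformation]
  ring

theorem SameParameters.depolarisedX_eq {σ ρ : QOp (PartyQubit m)} (h : SameParameters σ ρ) :
    depolarisedX σ = depolarisedX ρ := by
  have hX := h.2.1
  rw [errX, errX] at hX
  linarith

theorem secretFraction_ghz [Nonempty (Fin m)] : secretFraction (pureState (ghz m)) = 1 := by
  have hvalues (w : Bool → Bool → ℝ) (hw : IsBitChannel w) :
      {s : ℝ | ∃ (d : ℕ) (ψ : (PartyQubit m → Bool) × Fin d → ℂ),
        (∑ p, ‖ψ p‖ ^ 2 = 1) ∧ SameParameters (honestState ψ) (pureState (ghz m)) ∧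
        s = condEntropyEve w ψ - ⨆ i : Fin m, condEntropyBob w (honestState ψ) i} =
      {bitChannelInformation w} := by
    refine Set.Subset.antisymm ?_ (Set.singleton_subset_iff.mpr ?_)
    · rintro s ⟨d, ψ, hψ, hpar, rfl⟩
      exact condEntropyEve_sub_iSup_condEntropyBob hw hψ
        (hpar.depolarisedX_eq.trans depolarisedX_ghz)
    · have hghz : honestState (fun p : (PartyQubit m → Bool) × Fin 1 => ghz m p.1) =
          pureState (ghz m) := honestState_of_eq_mul (v := fun _ => 1) (by simp) (by simp)
      have hnorm : ∑ p : (PartyQubit m → Bool) × Fin 1, ‖ghz m p.1‖ ^ 2 = 1 := by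
        simp [Fintype.sum_prod_type, sum_norm_sq_ghz]
      exact ⟨1, _, hnorm, hghz ▸ ⟨rfl, rfl, fun _ => rfl⟩,
        (condEntropyEve_sub_iSup_condEntropyBob hw hnorm (hghz ▸ depolarisedX_ghz)).symm⟩
  refine IsGreatest.csSup_eq ⟨⟨_, isBitChannel_id, ?_⟩, ?_⟩
  · rw [hvalues _ isBitChannel_id, csInf_singleton, bitChannelInformation_id]
  · rintro r ⟨w, hw, rfl⟩
    rw [hvalues w hw, csInf_singleton]
    exact bitChannelInformation_le_one hw

theorem secretFraction2QKD_eq_one [Nonempty (Fin m)] : secretFraction2QKD m = 1 := by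
  simp only [secretFraction2QKD, reduce_pairEmb, secretFraction_ghz, ciInf_const]

theorem keyRate2QKD_eq [Nonempty (Fin m)] (cc : Bool) : keyRate2QKD cc m = (m : ℝ)⁻¹ := by
  rw [keyRate2QKD, secretFraction2QKD_eq_one, (isLeast_uses2QKD cc m).csInf_eq, one_div]

theorem keyRateNQKD_eq_one [Nonempty (Fin m)] (cc : Bool) : keyRateNQKD cc m = 1 := by
  rw [keyRateNQKD, secretFractionNQKD, secretFraction_ghz, (isLeast_usesNQKD cc).csInf_eq,
    Nat.cast_one, div_one]

end SecretFraction

end ConferenceQKD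

theorem mainTheorem5 (N : ℕ) (hN : 2 ≤ N) :
    -- moving one qubit across the cut raises the entropy of entanglement by at most 1
    (∀ (Q : Type) [Fintype Q] [DecidableEq Q] (ψ : (Q → Bool) → ℂ), ∑ x, ‖ψ x‖ ^ 2 = 1 →
      ∀ (A : Finset Q) (q : Q), q ∈ A →
        entanglementEntropy (A.erase q) ψ ≤ entanglementEntropy A ψ + 1) ∧
    -- by sending qubits from `A` to `B` (all of `B` acting jointly), only pure states with entropy
    -- of entanglement at most the number of qubits sent can be distributed
    (∀ (cc : Bool) (cs : List Unit) (T : Type) [Fintype T] (A : Finset T) (loc : T → Side)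
      (ψ : (T → Bool) → ℂ), (∀ t, t ∈ A ↔ loc t = Side.A) →
        Distributes cutSrc cutTgt cc cs loc (pureState ψ) →
          entanglementEntropy A ψ ≤ (cs.length : ℝ)) ∧
    -- `N - 1` Bell pairs have entropy of entanglement `N - 1`
    entanglementEntropy (alicePairQubits (N - 1)) (bellPairs (N - 1)) = (N : ℝ) - 1 ∧
    -- hence a single qubit sent from Alice does not suffice, neither if the router and the Bobs act
    -- jointly, nor in the network, whatever the use of the channels from the router to the Bobs
    (3 ≤ N → ∀ (cc : Bool) (cs : List Unit), cs.length ≤ 1 →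
      ¬ Distributes cutSrc cutTgt cc cs (fun t => side (pairLoc (N - 1) t))
        (pureState (bellPairs (N - 1)))) ∧
    (3 ≤ N → ∀ (cc : Bool) (cs : List (Channel (N - 1))), cs.count none ≤ 1 →
      ¬ Distributes (chanSrc (N - 1)) (chanTgt (N - 1)) cc cs (pairLoc (N - 1))
        (pureState (bellPairs (N - 1)))) ∧
    -- the bipartite protocol needs exactly `N - 1` network uses, the multipartite one a single use
    (∀ cc : Bool, IsLeast (uses2QKD cc (N - 1)) (N - 1) ∧ IsLeast (usesNQKD cc (N - 1)) 1) ∧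
    -- ideal key rates
    secretFractionNQKD (N - 1) = 1 ∧ secretFraction2QKD (N - 1) = 1 ∧
    (∀ cc : Bool, 0 < keyRate2QKD cc (N - 1) ∧
      keyRateNQKD cc (N - 1) = ((N : ℝ) - 1) * keyRate2QKD cc (N - 1)) := by
  have hm : 1 ≤ N - 1 := by omega
  have hcast : ((N - 1 : ℕ) : ℝ) = (N : ℝ) - 1 := by push_cast [show 1 ≤ N by omega]; rfl
  have : Nonempty (Fin (N - 1)) := ⟨⟨0, hm⟩⟩
  have hpos : (0 : ℝ) < (N - 1 : ℕ) := by exact_mod_cast hm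
  refine ⟨fun Q _ _ ψ hψ A q hq => entanglementEntropy_erase_le hq hψ,
    fun cc cs T _ A loc ψ hA => entanglementEntropy_le_length_of_distributes hA,
    hcast ▸ entanglementEntropy_bellPairs (N - 1), fun hN3 cc cs hcs h => ?_,
    fun hN3 cc cs hcs h => ?_, fun cc => ⟨isLeast_uses2QKD cc _, isLeast_usesNQKD cc⟩,
    secretFraction_ghz, secretFraction2QKD_eq_one, fun cc => ⟨?_, ?_⟩⟩
  · have := le_length_of_distributes_bellPairs h
    omega
  · have := le_count_none_of_distributes_bellPairs h
    omega
  · rw [keyRate2QKD_eq]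
    exact inv_pos.mpr hpos
  · rw [keyRateNQKD_eq_one, keyRate2QKD_eq, ← hcast, mul_inv_cancel₀ hpos.ne']
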